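/- Let $\Omega\subset\mathbb R^d$ be compact and let $D\subset\operatorname{int}\Omega$ (the obstacle) be such that $\Omega=\{G\le 0\}$, $D=\{F\le 0\}$ with $G,F\in C^2(\mathbb R^d)$, $\nabla G\neq 0$ on $\partial\Omega=\{G=0\}$ and $\nabla F\ne0$ on $\partial D=\{F=0\}$. Put $\mathbf n_D=\nabla F/\|\nabla F\|$ and $\mathbf n_\Omega=\nabla G/\|\nabla G\|$. Let $c\in C^3(\mathbb R^d)$ be positive on $\Omega$, put $H(x,\xi)=\frac12(c(x)^2\|\xi\|^2-1)$, and assume that $c$ is non-trapping: every solution of $$\dot x=\partial_\xi H,\qquad \dot\xi=-\partial_xH \tag{1}$$ with $x(0)\in\Omega$ and $H(x(0),\xi(0))=0$ leaves $\Omega$ in finite time. Fix $x^{0}\in\partial\Omega$ and let $\mathcal S=\{\zeta: H(x^0,\zeta)=0,\ c(x^0)^2\,\zeta\cdot \mathbf n_\Omega(x^0)<0\}$ be the set of inflow directions at $x^0$. For $\zeta\in\mathcal S$ the ray $X(s,x^0,\zeta)=(x(s,\zeta),\xi(s,\zeta))$ starts at $(x^0,\zeta)$ and follows (1). If it meets $\partial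 D$ before it reaches $\partial\Omega$, then at the first time $s^*$ at which it does so its covector is replaced by its reflection $(I-2\mathbf n_D\mathbf n_D^{T})\xi$, and it follows (1) afterwards (broken-once ray). The travel time $T(\zeta)$ is the smallest $t>0$ at which the ray is on $\partial\Omega$, and $x(T(\zeta),\zeta)$, $\xi(T(\zeta),\zeta)$ are the exit location and the exit direction. Let $\mathcal B(x^0)$ be the set of $\zeta\in\mathcal S$ whose ray meets $\partial D$ (tangentially or not) before it reaches $\partial\Omega$, let $\mathcal C(x^0)$ be the smallest simply connected subset of $\mathcal S$ that contains $\mathcal B(x^0)$, and let $\partial\mathcal C(x^0)$ be its boundary relative to $\mathcal S$. Let $\xi^0\in\partial\mathcal C(x^0)$, and assume that, if the ray from $(x^0,\xi^0)$ meets $\partial D$ for the first time tangentially, at $p=x(t_p)$, then * it exits non-tangentially: its exit phase $(y,\eta)$ satisfies $|\eta\cdot\mathbf n_\Omega(y)|>\delta$ for some $\delta>0$; * $\displaystyle \mathbf n_D(p)\cdot\frac{\partial\xi}{\partial s}\Big|_{t_p}+\Big(\frac{\partial x}{\partial s}\,\nabla\mathbf n_D\;\xi\Big)\Big|_{t_p}\neq0$,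 where the $s$-derivatives are given by (1); * $\mathbf n_D(p)$ is not parallel to $\xi^0$, and $\displaystyle\mathbf n_D(p)\cdot\frac{\partial x}{\partial\xi^0}\Big|_{t_p}\ne 0$, where $\partial x/\partial \xi^0$ is the derivative of the position of the solution of (1) at time $t_p$ with respect to the initial covector. Then at least one of the derivatives along $\mathcal S$, with respect to the initial direction $\zeta$, of the travel time $T(\zeta)$, the exit location $x(T(\zeta),\zeta)$ and the exit direction $\xi(T(\zeta),\zeta)$ is discontinuous at $\xi^0$, that is, it does not both exist at $\xi^0$ and depend continuously at $\xi^0$ on the directions at which it exists. -/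

import Mathlib

open Set
open scoped RealInnerProductSpace

namespace BrokenRay

/-- Physical space `ℝᵈ` with the Euclidean norm. -/
abbrev Space (d : ℕ) : Type := EuclideanSpace ℝ (Fin d)

/-- Phase space: pairs (position `x`, covector `ξ`). -/
abbrev Phase (d : ℕ) : Type := Space d × Space d

variable {d : ℕ}

/-! ### Hamiltonian system of the isotropic medium with speed `c` -/

/-- The Hamiltonian `H(x, ξ) = (c(x)² ‖ξ‖² - 1) / 2`. -/
noncomputable def hamiltonian (c : Space d → ℝ) (x ξ : Space d) : ℝ :=
  (c x ^ 2 * ‖ξ‖ ^ 2 - 1) / 2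

/-- The Hamiltonian vector field `(∂H/∂ξ, -∂H/∂x)`. -/
noncomputable def hamField (c : Space d → ℝ) (X : Phase d) : Phase d :=
  (gradient (fun ξ => hamiltonian c X.1 ξ) X.2,
    -gradient (fun x => hamiltonian c x X.2) X.1)

/-- On the time interval `[0, t]` the curve `γ` solves the Hamiltonian system and starts at the
phase `X`. -/
def IsRay (c : Space d → ℝ) (X : Phase d) (t : ℝ) (γ : ℝ → Phase d) : Prop :=
  γ 0 = X ∧ ∀ s ∈ Icc (0 : ℝ) t, HasDerivWithinAt γ (hamField c (γ s)) (Icc 0 t) s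

/-- The phase at time `t` of the (unreflected) Hamiltonian trajectory starting at `X`; the value is
unspecified if that trajectory does not exist up to time `t`. -/
noncomputable def flow (c : Space d → ℝ) (t : ℝ) (X : Phase d) : Phase d :=
  Classical.epsilon fun Y => ∃ γ, IsRay c X t γ ∧ γ t = Y

/-- The trajectory from `X` is at the phase `Y` at time `t > 0`, its position is then in `A`, and
at no earlier positive time is its position in `S`. -/
def Hits (c : Space d → ℝ) (A S : Set (Space d)) (X : Phase d) (t : ℝ) (Y : Phase d) : Prop :=
  0 < t ∧ ∃ γ, IsRay c X t γ ∧ γ t = Y ∧ Y.1 ∈ A ∧ ∀ s ∈ Ioo (0 : ℝ) t, (γ s).1 ∉ S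

/-- Non-trapping: every ray that starts in `Ω` leaves `Ω` in finite time. -/
def NonTrapping (c : Space d → ℝ) (Ω : Set (Space d)) : Prop :=
  ∀ x ∈ Ω, ∀ ξ, hamiltonian c x ξ = 0 →
    ∃ t, 0 < t ∧ ∃ γ, IsRay c (x, ξ) t γ ∧ (γ t).1 ∉ Ω

/-! ### Domains with `C²` boundary -/

/-- `F` is a `C²` defining function of `D`: `D = {F ≤ 0}` and the gradient of `F` does not vanish
on `{F = 0}`, which is therefore the boundary of `D`. -/
structure IsC2DefiningFunction (F : Space d → ℝ) (D : Set (Space d)) : Prop where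
  contDiff : ContDiff ℝ 2 F
  eq_sublevel : D = {x | F x ≤ 0}
  frontier_eq : frontier D = {x | F x = 0}
  gradient_ne_zero : ∀ x, F x = 0 → gradient F x ≠ 0

/-- The field `∇F / ‖∇F‖`; on `{F = 0}` it is the outward unit normal of `{F ≤ 0}`. -/
noncomputable def unitNormal (F : Space d → ℝ) (x : Space d) : Space d :=
  ‖gradient F x‖⁻¹ • gradient F x

/-- The inflow directions at the boundary point `x₀` of `{G ≤ 0}`: `H(x₀, ζ) = 0` and
`∑ gⁱʲ ζᵢ νⱼ = c(x₀)² ζ · ν(x₀) < 0`. -/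
def inflow (c G : Space d → ℝ) (x₀ : Space d) : Set (Space d) :=
  {ζ | hamiltonian c x₀ ζ = 0 ∧ c x₀ ^ 2 * ⟪ζ, unitNormal G x₀⟫ < 0}

/-! ### Broken rays -/

/-- Specular reflection of `ξ` at the point `x` of `{F = 0}`: `(I - 2 n nᵀ) ξ`. -/
noncomputable def reflect (F : Space d → ℝ) (x ξ : Space d) : Space d :=
  ξ - (2 * ⟪unitNormal F x, ξ⟫) • unitNormal F x

/-- The ray from `X` meets the obstacle `D` for the first time at time `s`, before reaching the
boundary of `Ω`, and `Z` is its phase there just before reflection. -/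
def MeetsObstacle (c : Space d → ℝ) (Ω D : Set (Space d)) (X : Phase d) (s : ℝ) (Z : Phase d) :
    Prop :=
  Hits c (frontier D) (frontier Ω ∪ frontier D) X s Z

/-- The ray from `X`, reflected when it meets the obstacle, reaches the boundary of `Ω` for the
first positive time at time `t`, with phase `Y`. Either it does not meet the obstacle, or it follows
the Hamiltonian system up to the reflection time `s`, is reflected there, and follows the
Hamiltonian system afterwards (broken-once ray). -/
def Exits (c F : Space d → ℝ) (Ω D : Set (Space d)) (X : Phase d) (t : ℝ) (Y : Phase d) : Prop :=
  Hits c (frontier Ω) (frontier Ω ∪ frontier D) X t Y ∨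
    ∃ s Z r, MeetsObstacle c Ω D X s Z ∧
      Hits c (frontier Ω) (frontier Ω) (Z.1, reflect F Z.1 Z.2) r Y ∧ t = s + r

/-- Exit time and exit phase of the ray from `X` (unspecified if the ray never exits). -/
noncomputable def exitData (c F : Space d → ℝ) (Ω D : Set (Space d)) (X : Phase d) : ℝ × Phase d :=
  Classical.epsilon fun e => Exits c F Ω D X e.1 e.2

/-- The travel time `T(ζ)` of the ray from `(x₀, ζ)`. -/
noncomputable def travelTime (c F : Space d → ℝ) (Ω D : Set (Space d)) (x₀ ζ : Space d) : ℝ :=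
  (exitData c F Ω D (x₀, ζ)).1

/-- The exit location of the ray from `(x₀, ζ)`. -/
noncomputable def exitLocation (c F : Space d → ℝ) (Ω D : Set (Space d)) (x₀ ζ : Space d) :
    Space d :=
  (exitData c F Ω D (x₀, ζ)).2.1

/-- The exit direction (covector) of the ray from `(x₀, ζ)`. -/
noncomputable def exitDirection (c F : Space d → ℝ) (Ω D : Set (Space d)) (x₀ ζ : Space d) :
    Space d :=
  (exitData c F Ω D (x₀, ζ)).2.2

/-- The set `𝓑(x₀)` of inflow directions whose ray meets the boundary of `D` (tangentially or not)
before it reaches the boundary of `Ω`. -/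
def brokenDirections (c G : Space d → ℝ) (Ω D : Set (Space d)) (x₀ : Space d) : Set (Space d) :=
  {ζ | ζ ∈ inflow c G x₀ ∧ ∃ t Z, Hits c (frontier D) (frontier Ω) (x₀, ζ) t Z}

/-- `C` is the smallest simply connected set of inflow directions at `x₀` that contains the broken
directions. -/
def IsSmallestSimplyConnected (c G : Space d → ℝ) (Ω D : Set (Space d)) (x₀ : Space d)
    (C : Set (Space d)) : Prop :=
  IsLeast {S | brokenDirections c G Ω D x₀ ⊆ S ∧ S ⊆ inflow c G x₀ ∧ IsSimplyConnected S} C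

/-- The ray from `(x₀, ζ)` meets the obstacle at time `s` in the phase `Z`, tangentially to the
boundary of `D`. -/
def IsTangential (c F : Space d → ℝ) (Ω D : Set (Space d)) (x₀ ζ : Space d) (s : ℝ)
    (Z : Phase d) : Prop :=
  MeetsObstacle c Ω D (x₀, ζ) s Z ∧ ⟪unitNormal F Z.1, Z.2⟫ = 0

/-- Tangential rays exit non-tangentially: if the ray from `(x₀, ζ)` is tangential to the boundary
of `D` and exits in the phase `Y`, then `|Y.2 · n(Y.1)| > δ` for some `δ > 0`. -/
def TransversalExit (c F G : Space d → ℝ) (Ω D : Set (Space d)) (x₀ ζ : Space d) : Prop :=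
  ∀ s Z, IsTangential c F Ω D x₀ ζ s Z → ∀ t Y, Exits c F Ω D (x₀, ζ) t Y →
    ∃ δ > 0, δ < |⟪Y.2, unitNormal G Y.1⟫|

/-- Nondegeneracy of a tangential ray from `(x₀, ζ)`: if it is tangential to the boundary of `D` at
`p = x(t_p)`, then, with `n = ∇F / ‖∇F‖`,
* `n_p · ∂ξ/∂s + (∂x/∂s ∇n) · ξ ≠ 0` at `t_p`, the `s`-derivatives being given by the Hamiltonian
  system;
* `n_p` is not parallel to `ζ`;
* the covector `n_p · ∂x/∂ζ` at `t_p` is not zero. -/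
def NondegenerateTangency (c F : Space d → ℝ) (Ω D : Set (Space d)) (x₀ ζ : Space d) : Prop :=
  ∀ s Z, IsTangential c F Ω D x₀ ζ s Z →
    ⟪unitNormal F Z.1, (hamField c Z).2⟫ +
        ⟪fderiv ℝ (unitNormal F) Z.1 (hamField c Z).1, Z.2⟫ ≠ 0 ∧
      (¬ ∃ a : ℝ, unitNormal F Z.1 = a • ζ) ∧
      ∃ v, ⟪unitNormal F Z.1, fderiv ℝ (fun η => (flow c s (x₀, η)).1) ζ v⟫ ≠ 0

/-! ### Derivatives in the initial direction -/

/-- The derivative of `f` along the set `S` of directions exists at `ξ` and, as a function on the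
set of those directions at which it exists, is continuous at `ξ`. A derivative along `S` matters
only on tangent vectors of `S`, whence the choice of linear maps `f'` on the ambient space that
represent it. -/
def HasContinuousDerivAt {V : Type*} [NormedAddCommGroup V] [NormedSpace ℝ V]
    (S : Set (Space d)) (f : Space d → V) (ξ : Space d) : Prop :=
  DifferentiableWithinAt ℝ f S ξ ∧
    ∃ f' : Space d → Space d →L[ℝ] V,
      (∀ ζ ∈ S, DifferentiableWithinAt ℝ f S ζ → HasFDerivWithinAt f (f' ζ) S ζ) ∧
        ContinuousWithinAt f' {ζ | ζ ∈ S ∧ DifferentiableWithinAt ℝ f S ζ} ξ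

end BrokenRay

open BrokenRay

namespace BrokenRay

variable {d : ℕ}

/-! ### The Hamiltonian vector field -/

/-! Let `γ₀` be the free ray from `(x₀, ξ₀)`, with the obstacle ignored, and `T` its first time on
`∂Ω`. Suppose the three exit functions are differentiable at `ξ₀`; the contradiction depends on how
`γ₀` meets `D` before `T`.

Crossing: if `n · ξ ≠ 0` at the first contact, `γ₀` enters the interior of `D`, and so do all nearby
rays. Thus `ξ₀` is interior to `𝓑`, hence to `C` (`brokenDirections_mem_nhdsWithin`).

Missing: `ξ₀` is still a limit of broken directions. Indeed, if `∂C` had a point off the closure of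
`𝓑`, a homeomorphism fixing `𝓑` and pushing a point of `C` out of `C` would contradict minimality
(`frontier_subset_closure_of_isLeast`). But `γ₀` stays off `D` a little beyond `T`, so nearby broken
rays meet `D` only after some `T' > T`, and the travel time jumps
(`not_continuousWithinAt_travelTime`).

Grazing: differentiability makes the exit data Lipschitz at `ξ₀`. Running rays backwards from their
exits, the covectors before and after reflection differ by `O(|ζ - ξ₀|)`; this difference has norm
`2|n · ξ|`, so nearby contacts are tangential up to `O(|ζ - ξ₀|)`
(`exists_abs_inner_unitNormal_le`). On the other hand, `n · ∂x/∂ξ⁰ ≠ 0` supplies directions at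
distance `O(ε)` whose free rays reach depth `F ≤ -κε` (`exists_entering_directions`). Near the
tangency `n · ξ` increases along rays (`normalRate_pos`), so after contact it stays above `-O(ε)`,
and within a time `2δ` the depth is at most `O(ε)δ`. For small `δ` this is less than `κε`
(`not_lipschitz_of_tangential`). -/

theorem hamField_eq {c : Space d → ℝ} (hc : Differentiable ℝ c) (X : Phase d) :
    hamField c X = (c X.1 ^ 2 • X.2, -((c X.1 * ‖X.2‖ ^ 2) • gradient c X.1)) := by
  have h1 : HasGradientAt (fun ξ => hamiltonian c X.1 ξ) (c X.1 ^ 2 • X.2) X.2 := by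
    rw [hasGradientAt_iff_hasFDerivAt]
    have h := ((((hasStrictFDerivAt_norm_sq X.2).hasFDerivAt).const_mul (c X.1 ^ 2)).sub_const
      1).mul_const 2⁻¹
    simp only [hamiltonian, div_eq_mul_inv]
    refine h.congr_fderiv ?_
    ext v
    simp
    ring
  have h2 : HasGradientAt (fun x => hamiltonian c x X.2)
      ((c X.1 * ‖X.2‖ ^ 2) • gradient c X.1) X.1 := by
    rw [hasGradientAt_iff_hasFDerivAt]
    have h := ((((hc X.1).hasFDerivAt.pow 2).mul_const (‖X.2‖ ^ 2)).sub_const 1).mul_const 2⁻¹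
    simp only [hamiltonian, div_eq_mul_inv]
    refine h.congr_fderiv ?_
    ext v
    simp
    ring
  rw [hamField, h1.gradient, h2.gradient]

theorem contDiff_gradient {f : Space d → ℝ} {m n : ℕ} (hf : ContDiff ℝ n f) (hmn : m + 1 ≤ n) :
    ContDiff ℝ m (gradient f) := by
  have h : ContDiff ℝ m (fderiv ℝ f) := hf.fderiv_right (by exact_mod_cast hmn)
  exact (InnerProductSpace.toDual ℝ (Space d)).symm.contDiff.comp h

theorem contDiff_hamField {c : Space d → ℝ} (hc : ContDiff ℝ 3 c) :
    ContDiff ℝ 1 (hamField c) := by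
  have hd : Differentiable ℝ c := hc.differentiable (by norm_num)
  have hg : ContDiff ℝ (1 : ℕ) (gradient c) := contDiff_gradient (n := 3) hc (by norm_num)
  have h1 : ContDiff ℝ 1 c := hc.of_le (by norm_num)
  have e : hamField c =
      fun X : Phase d => (c X.1 ^ 2 • X.2, -((c X.1 * ‖X.2‖ ^ 2) • gradient c X.1)) :=
    funext (hamField_eq hd)
  rw [e]
  have hg' : ContDiff ℝ 1 (fun X : Phase d => gradient c X.1) := by
    exact ContDiff.comp (g := gradient c) (by exact_mod_cast hg) contDiff_fst
  have hc' : ContDiff ℝ 1 (fun X : Phase d => c X.1) := h1.comp contDiff_fst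
  have hn : ContDiff ℝ 1 (fun X : Phase d => ‖X.2‖ ^ 2) := contDiff_snd.norm_sq ℝ
  exact ((hc'.pow 2).smul contDiff_snd).prodMk (((hc'.mul hn).smul hg').neg)

/-! ### Elementary operations on rays -/

namespace IsRay

variable {c : Space d → ℝ} {X : Phase d} {t : ℝ} {γ : ℝ → Phase d}

theorem continuousOn (h : IsRay c X t γ) : ContinuousOn γ (Icc 0 t) :=
  fun s hs => (h.2 s hs).continuousWithinAt

theorem mono (h : IsRay c X t γ) {t' : ℝ} (ht : t' ≤ t) : IsRay c X t' γ :=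
  ⟨h.1, fun s hs => (h.2 s ⟨hs.1, hs.2.trans ht⟩).mono (Icc_subset_Icc_right ht)⟩

theorem shift (h : IsRay c X t γ) {a : ℝ} (ha : 0 ≤ a) :
    IsRay c (γ a) (t - a) (fun u => γ (a + u)) := by
  refine ⟨by simp, fun s hs => ?_⟩
  have hs' : a + s ∈ Icc 0 t := ⟨by linarith [hs.1], by linarith [hs.2]⟩
  have := (h.2 (a + s) hs').scomp s
    (((hasDerivAt_id s).const_add a).hasDerivWithinAt (s := Icc 0 (t - a)))
    (fun u hu => ⟨by simpa using (by linarith [hu.1] : 0 ≤ a + u),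
      by simpa using (by linarith [hu.2] : a + u ≤ t)⟩)
  simpa [Function.comp_def] using this

/-- `H` is even in `ξ`, so time reversal with `ξ ↦ -ξ` preserves the system. This allows exit phases
to be traced back to the reflection. -/
theorem reverse (hc : Differentiable ℝ c) (h : IsRay c X t γ) :
    IsRay c ((γ t).1, -(γ t).2) t (fun u => ((γ (t - u)).1, -(γ (t - u)).2)) := by
  refine ⟨by simp, fun s hs => ?_⟩
  have hs' : t - s ∈ Icc 0 t := ⟨by linarith [hs.2], by linarith [hs.1]⟩
  have := (h.2 (t - s) hs').scomp s
    (((hasDerivAt_id s).const_sub t).hasDerivWithinAt (s := Icc 0 t))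
    (fun u hu => ⟨by simpa using (by linarith [hu.2] : 0 ≤ t - u),
      by simpa using (by linarith [hu.1] : t - u ≤ t)⟩)
  have h1 := (ContinuousLinearMap.fst ℝ (Space d) (Space d)).hasFDerivAt.comp_hasDerivWithinAt s this
  have h2 := (ContinuousLinearMap.snd ℝ (Space d) (Space d)).hasFDerivAt.comp_hasDerivWithinAt s this
  have h3 := h1.prodMk h2.neg
  refine h3.congr_deriv ?_
  simp [hamField_eq hc]

/-- `H + 1/2` is homogeneous of degree two in `ξ`: multiplying the covector by `b` keeps the path
and multiplies the speed by `b`. Perturbed covectors can thus be brought back to `H = 0`. -/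
theorem scale (hc : Differentiable ℝ c) (h : IsRay c X t γ) {b : ℝ} (hb : 0 < b) :
    IsRay c (X.1, b • X.2) (t / b) (fun u => ((γ (b * u)).1, b • (γ (b * u)).2)) := by
  refine ⟨by simp [h.1], fun s hs => ?_⟩
  have key : ∀ u ∈ Icc 0 (t / b), b * u ∈ Icc 0 t := fun u hu =>
    ⟨mul_nonneg hb.le hu.1, by have := (le_div_iff₀ hb).1 hu.2; linarith⟩
  have := (h.2 (b * s) (key s hs)).scomp s
    (((hasDerivAt_id s).const_mul b).hasDerivWithinAt (s := Icc 0 (t / b))) key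
  have h1 := (ContinuousLinearMap.fst ℝ (Space d) (Space d)).hasFDerivAt.comp_hasDerivWithinAt s this
  have h2 := (ContinuousLinearMap.snd ℝ (Space d) (Space d)).hasFDerivAt.comp_hasDerivWithinAt s this
  have h3 := h1.prodMk (h2.const_smul b)
  refine h3.congr_deriv ?_
  simp only [hamField_eq hc, mul_one, Prod.smul_mk, ContinuousLinearMap.coe_fst',
    ContinuousLinearMap.coe_snd', norm_smul, Real.norm_eq_abs, mul_pow, sq_abs, smul_neg, smul_smul]
  refine Prod.ext ?_ ?_
  · simp only [mul_comm]
  · simp only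
    congr 2
    ring

/-- The Hamiltonian is conserved along rays. -/
theorem hamiltonian_eq_zero (hc : Differentiable ℝ c) (h : IsRay c X t γ)
    (hX : hamiltonian c X.1 X.2 = 0) {s : ℝ} (hs : s ∈ Icc 0 t) :
    hamiltonian c (γ s).1 (γ s).2 = 0 := by
  have hd : ∀ u ∈ Icc 0 t,
      HasDerivWithinAt (fun u => hamiltonian c (γ u).1 (γ u).2) 0 (Icc 0 t) u := by
    intro u hu
    have h1 := (ContinuousLinearMap.fst ℝ (Space d) (Space d)).hasFDerivAt.comp_hasDerivWithinAt u
      (h.2 u hu)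
    have h2 := (ContinuousLinearMap.snd ℝ (Space d) (Space d)).hasFDerivAt.comp_hasDerivWithinAt u
      (h.2 u hu)
    have h3 := (hc (γ u).1).hasFDerivAt.comp_hasDerivWithinAt u h1
    have h4 := (((h3.pow 2).mul h2.norm_sq).sub_const 1).div_const 2
    refine h4.congr_deriv ?_
    simp [hamField_eq hc, inner_smul_right, inner_gradient_right]
    ring
  have := constant_of_has_deriv_right_zero (fun u hu => (hd u hu).continuousWithinAt)
    (fun u hu => (hd u ⟨hu.1, hu.2.le⟩).mono_of_mem_nhdsWithin
      (Icc_mem_nhdsGE_of_mem hu)) s hs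
  rw [this, h.1, hX]

end IsRay

/-! ### First zeros, and continuous dependence of rays on the initial phase -/

theorem exists_first_zero {f : ℝ → ℝ} {a b : ℝ} (hf : ContinuousOn f (Icc a b)) (hab : a ≤ b)
    (ha : f a < 0) (hb : 0 ≤ f b) : ∃ τ ∈ Ioc a b, f τ = 0 ∧ ∀ u ∈ Ico a τ, f u < 0 := by
  have hcl : IsClosed (Icc a b ∩ f ⁻¹' Ici 0) :=
    hf.preimage_isClosed_of_isClosed isClosed_Icc isClosed_Ici
  have hcomp : IsCompact (Icc a b ∩ f ⁻¹' Ici 0) :=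
    isCompact_Icc.of_isClosed_subset hcl inter_subset_left
  obtain ⟨τ, ⟨hτ, hτ0⟩, hleast⟩ := hcomp.exists_isLeast ⟨b, ⟨hab, le_rfl⟩, hb⟩
  have hneg : ∀ u ∈ Ico a τ, f u < 0 := fun u hu => by
    by_contra h
    exact absurd (hleast ⟨⟨hu.1, hu.2.le.trans hτ.2⟩, not_lt.1 h⟩) (not_le.2 hu.2)
  have haτ : a < τ := lt_of_le_of_ne hτ.1 fun h => by
    rw [← h] at hτ0; exact absurd hτ0 (not_le.2 ha)
  refine ⟨τ, ⟨haτ, hτ.2⟩, le_antisymm ?_ hτ0, hneg⟩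
  have hcw : ContinuousWithinAt f (Ico a τ) τ :=
    (hf τ hτ).mono fun u hu => ⟨hu.1, hu.2.le.trans hτ.2⟩
  have : (nhdsWithin τ (Ico a τ)).NeBot := by
    rw [nhdsWithin_Ico_eq_nhdsLT haτ]; infer_instance
  exact le_of_tendsto hcw (Filter.eventually_of_mem self_mem_nhdsWithin fun u hu => (hneg u hu).le)

theorem exists_lipschitzOnWith_closedBall {E V : Type*} [NormedAddCommGroup E] [NormedSpace ℝ E]
    [ProperSpace E] [NormedAddCommGroup V] [NormedSpace ℝ V] {f : E → V} (hf : ContDiff ℝ 1 f)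
    (R : ℝ) : ∃ K, LipschitzOnWith K f (Metric.closedBall 0 R) := by
  have hcont : Continuous fun x => ‖fderiv ℝ f x‖₊ := (hf.continuous_fderiv one_ne_zero).nnnorm
  obtain ⟨K, hK⟩ := ((isCompact_closedBall (0 : E) R).image hcont).bddAbove
  exact ⟨K, (convex_closedBall 0 R).lipschitzOnWith_of_nnnorm_fderiv_le
    (fun x _ => hf.differentiable one_ne_zero x) fun x hx => hK (mem_image_of_mem _ hx)⟩

theorem IsRay.exists_closedBall {c : Space d → ℝ} {X : Phase d} {t : ℝ} {γ : ℝ → Phase d}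
    (h : IsRay c X t γ) : ∃ R, ∀ u ∈ Icc 0 t, γ u ∈ Metric.closedBall 0 R := by
  obtain ⟨R, hR⟩ := (isCompact_Icc.image_of_continuousOn h.continuousOn).isBounded.subset_closedBall 0
  exact ⟨R, fun u hu => hR (mem_image_of_mem _ hu)⟩

/-- Grönwall's inequality, with a bootstrap because the field is only locally Lipschitz. Existence
of the nearby ray up to `t₀` is not claimed; `K` and `δ` do not depend on how long it lives. -/
theorem IsRay.exists_dist_le {c : Space d → ℝ} (hc : ContDiff ℝ 3 c) {X₀ : Phase d} {t₀ : ℝ}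
    {γ₀ : ℝ → Phase d} (h₀ : IsRay c X₀ t₀ γ₀) :
    ∃ K > 0, ∃ δ > 0, ∀ X t γ, IsRay c X t γ → t ≤ t₀ → dist X X₀ < δ →
      ∀ s ∈ Icc 0 t, dist (γ s) (γ₀ s) ≤ K * dist X X₀ := by
  obtain ⟨R, hR⟩ := h₀.exists_closedBall
  obtain ⟨L, hL⟩ := exists_lipschitzOnWith_closedBall (contDiff_hamField hc) (R + 1)
  -- The choice `δ = K⁻¹` keeps the Grönwall bound below `1`, hence the nearby ray inside the ball
  -- of radius `R + 1`.
  refine ⟨Real.exp (L * t₀), Real.exp_pos _, (Real.exp (L * t₀))⁻¹, by positivity,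
    fun X t γ h ht hX => ?_⟩
  have hXK : Real.exp (L * t₀) * dist X X₀ < 1 := by
    have := mul_lt_mul_of_pos_left hX (Real.exp_pos (L * t₀))
    rwa [mul_inv_cancel₀ (Real.exp_pos _).ne'] at this
  have h₀' := h₀.mono ht
  have gronwall : ∀ τ ∈ Icc 0 t, (∀ u ∈ Ico 0 τ, dist (γ u) (γ₀ u) < 1) →
      dist (γ τ) (γ₀ τ) ≤ Real.exp (L * t₀) * dist X X₀ := by
    intro τ hτ hclose
    have hr := h.mono hτ.2
    have hr₀ := h₀'.mono hτ.2
    have hder : ∀ {Z : Phase d} {ρ : ℝ → Phase d}, IsRay c Z τ ρ → ∀ u ∈ Ico 0 τ,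
        HasDerivWithinAt ρ (hamField c (ρ u)) (Ici u) u := fun hρ u hu =>
      (hρ.2 u ⟨hu.1, hu.2.le⟩).mono_of_mem_nhdsWithin (Icc_mem_nhdsGE_of_mem hu)
    have hball : ∀ u ∈ Ico 0 τ, γ₀ u ∈ Metric.closedBall 0 R := fun u hu =>
      hR u ⟨hu.1, hu.2.le.trans (hτ.2.trans ht)⟩
    have := dist_le_of_trajectories_ODE_of_mem (v := fun _ => hamField c)
      (s := fun _ => Metric.closedBall 0 (R + 1)) (fun _ _ => hL) hr.continuousOn (hder hr)
      (fun u hu => by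
        have h1 := hball u hu
        have h2 := hclose u hu
        rw [Metric.mem_closedBall] at h1 ⊢
        linarith [dist_triangle (γ u) (γ₀ u) 0])
      hr₀.continuousOn (hder hr₀)
      (fun u hu => Metric.closedBall_subset_closedBall (by linarith) (hball u hu))
      (by rw [h.1, h₀.1]) τ ⟨hτ.1, le_rfl⟩
    refine this.trans ?_
    rw [mul_comm]
    gcongr
    linarith [hτ.2]
  -- Bootstrap: at a first time when the distance equals `1`, Grönwall up to that time would give a
  -- distance below `1`.
  have hlt : ∀ u ∈ Icc 0 t, dist (γ u) (γ₀ u) < 1 := by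
    intro u hu
    by_contra hge
    have hcont : ContinuousOn (fun u => dist (γ u) (γ₀ u) - 1) (Icc 0 u) :=
      (continuous_dist.comp_continuousOn
        ((h.mono hu.2).continuousOn.prodMk (h₀'.mono hu.2).continuousOn)).sub continuousOn_const
    have hinit : dist (γ 0) (γ₀ 0) - 1 < 0 := by
      rw [h.1, h₀.1]
      have : 1 ≤ Real.exp (L * t₀) :=
        Real.one_le_exp (mul_nonneg L.2 (hu.1.trans (hu.2.trans ht)))
      nlinarith [dist_nonneg (x := X) (y := X₀)]
    obtain ⟨τ, hτ, hτ1, hτlt⟩ := exists_first_zero hcont hu.1 hinit (by linarith)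
    have := gronwall τ ⟨hτ.1.le, hτ.2.trans hu.2⟩ fun v hv => by linarith [hτlt v hv]
    linarith
  exact fun s hs => gronwall s hs fun u hu => hlt u ⟨hu.1, hu.2.le.trans hs.2⟩

theorem IsRay.eq_of_isRay {c : Space d → ℝ} (hc : ContDiff ℝ 3 c) {X : Phase d} {t t' : ℝ}
    {γ γ' : ℝ → Phase d} (h : IsRay c X t γ) (h' : IsRay c X t' γ') {s : ℝ} (hs : s ∈ Icc 0 t)
    (hs' : s ∈ Icc 0 t') : γ s = γ' s := by
  obtain ⟨K, _, δ, hδ, H⟩ := (h'.mono hs'.2).exists_dist_le hc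
  have := H X s γ (h.mono hs.2) le_rfl (by simpa) s ⟨hs.1, le_rfl⟩
  simpa using this

theorem flow_eq {c : Space d → ℝ} (hc : ContDiff ℝ 3 c) {X : Phase d} {t : ℝ} {γ : ℝ → Phase d}
    (h : IsRay c X t γ) (ht : 0 ≤ t) : flow c t X = γ t := by
  obtain ⟨γ', h', e⟩ := Classical.epsilon_spec (p := fun Y => ∃ γ, IsRay c X t γ ∧ γ t = Y)
    ⟨γ t, γ, h, rfl⟩
  rw [flow, ← e]
  exact h'.eq_of_isRay hc h ⟨ht, le_rfl⟩ ⟨ht, le_rfl⟩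

theorem IsRay.exists_dist_le_mul_abs {c : Space d → ℝ} (hc : ContDiff ℝ 3 c) {X : Phase d} {t : ℝ}
    {γ : ℝ → Phase d} (h : IsRay c X t γ) :
    ∃ K ≥ 0, ∀ u ∈ Icc 0 t, ∀ v ∈ Icc 0 t, dist (γ u) (γ v) ≤ K * |u - v| := by
  have hcont : ContinuousOn (fun u => ‖hamField c (γ u)‖) (Icc 0 t) :=
    ((contDiff_hamField hc).continuous.comp_continuousOn h.continuousOn).norm
  obtain ⟨K, hK⟩ := (isCompact_Icc.image_of_continuousOn hcont).bddAbove
  refine ⟨max K 0, le_max_right _ _, fun u hu v hv => ?_⟩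
  rw [dist_eq_norm, ← Real.norm_eq_abs]
  exact (convex_Icc 0 t).norm_image_sub_le_of_norm_hasDerivWithin_le h.2
    (fun w hw => (hK (mem_image_of_mem _ hw)).trans (le_max_left _ _)) hv hu

/-- Compactness of the arc gives a uniform radius, so strict inequalities along a ray pass to nearby
rays. -/
theorem IsRay.exists_tube {c : Space d → ℝ} {X : Phase d} {t : ℝ} {γ : ℝ → Phase d}
    (h : IsRay c X t γ) {g : Phase d → ℝ} (hg : Continuous g) {a b : ℝ} (ha : 0 ≤ a) (hb : b ≤ t)
    (hneg : ∀ u ∈ Icc a b, g (γ u) < 0) :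
    ∃ ρ > 0, ∀ u ∈ Icc a b, ∀ Z, dist Z (γ u) < ρ → g Z < 0 := by
  have hcomp : IsCompact (γ '' Icc a b) :=
    isCompact_Icc.image_of_continuousOn (h.continuousOn.mono (Icc_subset_Icc ha hb))
  obtain ⟨ρ, hρ, hsub⟩ := hcomp.exists_thickening_subset_open (isOpen_Iio.preimage hg)
    (by rintro _ ⟨u, hu, rfl⟩; exact hneg u hu)
  exact ⟨ρ, hρ, fun u hu Z hZ => hsub (Metric.mem_thickening_iff.2 ⟨γ u, mem_image_of_mem _ hu, hZ⟩)⟩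

/-- Along a ray, the derivative of `f` is the derivative of `f` in the direction
`c ^ 2 • ξ` of motion. -/
theorem IsRay.hasDerivWithinAt_comp_fst {c : Space d → ℝ} (hc : Differentiable ℝ c) {X : Phase d}
    {t : ℝ} {γ : ℝ → Phase d} (h : IsRay c X t γ) {f : Space d → ℝ} (hf : Differentiable ℝ f)
    {s : ℝ} (hs : s ∈ Icc 0 t) :
    HasDerivWithinAt (fun u => f (γ u).1) (c (γ s).1 ^ 2 * ⟪gradient f (γ s).1, (γ s).2⟫)
      (Icc 0 t) s := by
  have h1 := (ContinuousLinearMap.fst ℝ (Space d) (Space d)).hasFDerivAt.comp_hasDerivWithinAt s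
    (h.2 s hs)
  refine ((hf (γ s).1).hasFDerivAt.comp_hasDerivWithinAt s h1).congr_deriv ?_
  simp [hamField_eq hc, inner_gradient_left]

/-! ### Uniqueness of hits -/

theorem Hits.unique {c : Space d → ℝ} (hc : ContDiff ℝ 3 c) {A A' S : Set (Space d)}
    {X Y Y' : Phase d} {t t' : ℝ} (h : Hits c A S X t Y) (h' : Hits c A' S X t' Y') (hA : A ⊆ S)
    (hA' : A' ⊆ S) : t = t' ∧ Y = Y' := by
  obtain ⟨ht, γ, hγ, rfl, hY, hno⟩ := h
  obtain ⟨ht', γ', hγ', rfl, hY', hno'⟩ := h'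
  rcases lt_trichotomy t t' with hlt | rfl | hlt
  · have e := hγ.eq_of_isRay hc hγ' ⟨ht.le, le_rfl⟩ ⟨ht.le, hlt.le⟩
    exact absurd (hA (e ▸ hY)) (hno' t ⟨ht, hlt⟩)
  · exact ⟨rfl, hγ.eq_of_isRay hc hγ' ⟨ht.le, le_rfl⟩ ⟨ht.le, le_rfl⟩⟩
  · have e := hγ'.eq_of_isRay hc hγ ⟨ht'.le, le_rfl⟩ ⟨ht'.le, hlt.le⟩
    exact absurd (hA' (e ▸ hY')) (hno t' ⟨ht', hlt⟩)

/-- Makes the choice in `exitData` irrelevant. The two ways of exiting exclude each other because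
the first contact cannot lie on both disjoint boundaries. -/
theorem Exits.unique {c F : Space d → ℝ} (hc : ContDiff ℝ 3 c) {Ω D : Set (Space d)}
    (hdisj : Disjoint (frontier Ω) (frontier D)) {X Y Y' : Phase d} {t t' : ℝ}
    (h : Exits c F Ω D X t Y) (h' : Exits c F Ω D X t' Y') : t = t' ∧ Y = Y' := by
  have clash : ∀ {t s Y Z}, Hits c (frontier Ω) (frontier Ω ∪ frontier D) X t Y →
      ¬ MeetsObstacle c Ω D X s Z := by
    intro t s Y Z h1 h2
    have e := h1.unique hc h2 subset_union_left subset_union_right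
    obtain ⟨_, γ, _, _, hA, _⟩ := h1
    obtain ⟨_, γ', _, _, hA', _⟩ := h2
    exact hdisj.le_bot ⟨hA, e.2 ▸ hA'⟩
  rcases h with h | ⟨s, Z, r, hm, hh, rfl⟩ <;> rcases h' with h' | ⟨s', Z', r', hm', hh', rfl⟩
  · exact h.unique hc h' subset_union_left subset_union_left
  · exact (clash h hm').elim
  · exact (clash h' hm).elim
  · obtain ⟨rfl, rfl⟩ := Hits.unique hc hm hm' subset_union_right subset_union_right
    obtain ⟨rfl, rfl⟩ := hh.unique hc hh' subset_rfl subset_rfl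
    exact ⟨rfl, rfl⟩

theorem Exits.exitData_eq {c F : Space d → ℝ} (hc : ContDiff ℝ 3 c) {Ω D : Set (Space d)}
    (hdisj : Disjoint (frontier Ω) (frontier D)) {X Y : Phase d} {t : ℝ}
    (h : Exits c F Ω D X t Y) : exitData c F Ω D X = (t, Y) := by
  have := Classical.epsilon_spec (p := fun e : ℝ × Phase d => Exits c F Ω D X e.1 e.2) ⟨(t, Y), h⟩
  obtain ⟨h1, h2⟩ := Exits.unique hc hdisj this h
  exact Prod.ext h1 h2

/-! ### Domains with an obstacle -/

theorem IsC2DefiningFunction.mem_frontier_iff {F : Space d → ℝ} {D : Set (Space d)}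
    (h : IsC2DefiningFunction F D) {x : Space d} : x ∈ frontier D ↔ F x = 0 := by
  rw [h.frontier_eq, mem_ofPred_eq]

theorem IsC2DefiningFunction.mem_iff {F : Space d → ℝ} {D : Set (Space d)}
    (h : IsC2DefiningFunction F D) {x : Space d} : x ∈ D ↔ F x ≤ 0 := by
  conv_lhs => rw [h.eq_sublevel]
  exact Iff.rfl

theorem IsC2DefiningFunction.lt_zero_of_mem_interior {F : Space d → ℝ} {D : Set (Space d)}
    (h : IsC2DefiningFunction F D) {x : Space d} (hx : x ∈ interior D) : F x < 0 :=
  lt_of_le_of_ne (h.mem_iff.1 (interior_subset hx)) fun e => (h.mem_frontier_iff.2 e).2 hx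

theorem IsC2DefiningFunction.differentiable {F : Space d → ℝ} {D : Set (Space d)}
    (h : IsC2DefiningFunction F D) : Differentiable ℝ F :=
  h.contDiff.differentiable (by norm_num)

theorem IsC2DefiningFunction.continuous_gradient {F : Space d → ℝ} {D : Set (Space d)}
    (h : IsC2DefiningFunction F D) : Continuous (gradient F) :=
  (contDiff_gradient (n := 2) (m := 1) h.contDiff (by norm_num)).continuous

theorem norm_unitNormal {F : Space d → ℝ} {x : Space d} (h : gradient F x ≠ 0) :
    ‖unitNormal F x‖ = 1 := by
  rw [unitNormal, norm_smul, norm_inv, norm_norm, inv_mul_cancel₀ (norm_ne_zero_iff.2 h)]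

theorem gradient_eq_smul_unitNormal {F : Space d → ℝ} {x : Space d} (h : gradient F x ≠ 0) :
    gradient F x = ‖gradient F x‖ • unitNormal F x := by
  rw [unitNormal, smul_smul, mul_inv_cancel₀ (norm_ne_zero_iff.2 h), one_smul]

theorem norm_reflect {F : Space d → ℝ} {x : Space d} (h : gradient F x ≠ 0) (ξ : Space d) :
    ‖reflect F x ξ‖ = ‖ξ‖ := by
  have hn := norm_unitNormal h
  have : ‖reflect F x ξ‖ ^ 2 = ‖ξ‖ ^ 2 := by
    rw [reflect, norm_sub_sq_real, norm_smul, hn, inner_smul_right, real_inner_comm ξ, mul_one,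
      Real.norm_eq_abs, sq_abs]
    ring
  exact (sq_eq_sq₀ (norm_nonneg _) (norm_nonneg _)).1 this

/-- The standing assumptions on the medium, the domain and the obstacle. -/
structure IsMedium (c F G : Space d → ℝ) (Ω D : Set (Space d)) : Prop where
  defG : IsC2DefiningFunction G Ω
  defF : IsC2DefiningFunction F D
  subset_interior : D ⊆ interior Ω
  contDiff : ContDiff ℝ 3 c
  pos : ∀ x ∈ Ω, 0 < c x
  nonTrapping : NonTrapping c Ω

namespace IsMedium

variable {c F G : Space d → ℝ} {Ω D : Set (Space d)}

theorem differentiable (M : IsMedium c F G Ω D) : Differentiable ℝ c :=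
  M.contDiff.differentiable (by norm_num)

theorem G_neg_of_F_nonpos (M : IsMedium c F G Ω D) {x : Space d} (hx : F x ≤ 0) : G x < 0 :=
  M.defG.lt_zero_of_mem_interior (M.subset_interior (M.defF.mem_iff.2 hx))

theorem F_pos_of_G_nonneg (M : IsMedium c F G Ω D) {x : Space d} (hx : 0 ≤ G x) : 0 < F x := by
  by_contra h
  exact absurd (M.G_neg_of_F_nonpos (not_lt.1 h)) (not_lt.2 hx)

theorem disjoint_frontier (M : IsMedium c F G Ω D) : Disjoint (frontier Ω) (frontier D) := by
  rw [Set.disjoint_left]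
  intro x hx hx'
  rw [M.defG.mem_frontier_iff] at hx
  rw [M.defF.mem_frontier_iff] at hx'
  exact absurd (M.G_neg_of_F_nonpos hx'.le) (by rw [hx]; exact lt_irrefl 0)

theorem inflow_iff (M : IsMedium c F G Ω D) {x₀ : Space d} (hx₀ : G x₀ = 0) {ζ : Space d} :
    ζ ∈ inflow c G x₀ ↔ hamiltonian c x₀ ζ = 0 ∧ ⟪gradient G x₀, ζ⟫ < 0 := by
  have hg := M.defG.gradient_ne_zero x₀ hx₀
  have hc := M.pos x₀ (M.defG.mem_iff.2 hx₀.le)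
  rw [inflow, mem_ofPred_eq, unitNormal, inner_smul_right, real_inner_comm]
  have h1 : 0 < ‖gradient G x₀‖⁻¹ := inv_pos.2 (norm_pos_iff.2 hg)
  rw [← mul_assoc, mul_neg_iff]
  constructor
  · rintro ⟨h, h' | h'⟩
    · exact ⟨h, h'.2⟩
    · exact absurd h'.1 (not_lt.2 (by positivity))
  · rintro ⟨h, h'⟩
    exact ⟨h, Or.inl ⟨by positivity, h'⟩⟩

/-- Rays close to an inflowing ray enter the interior of the domain immediately, uniformly. -/
theorem exists_entering (M : IsMedium c F G Ω D) {x₀ ξ₀ : Space d} (hx₀ : G x₀ = 0)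
    (hξ₀ : ξ₀ ∈ inflow c G x₀) {t₀ : ℝ} (ht₀ : 0 < t₀) {γ₀ : ℝ → Phase d}
    (h₀ : IsRay c (x₀, ξ₀) t₀ γ₀) :
    ∃ δ ∈ Ioc 0 t₀, ∃ ρ > 0, ∀ X t γ, IsRay c X t γ → G X.1 = 0 → t ≤ δ →
      (∀ u ∈ Icc 0 t, dist (γ u) (γ₀ u) < ρ) → ∀ u ∈ Ioc 0 t, G (γ u).1 < 0 := by
  -- `g` is the derivative of `G` along rays. As `G = 0` at the start, no tube for `G < 0` reaches
  -- time `0`; a tube for `g < 0` does, and gives monotonicity of `G`.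
  set g : Phase d → ℝ := fun Z => c Z.1 ^ 2 * ⟪gradient G Z.1, Z.2⟫ with hg
  have hgc : Continuous g := ((M.contDiff.continuous.comp continuous_fst).pow 2).mul
    ((M.defG.continuous_gradient.comp continuous_fst).inner continuous_snd)
  have hc := M.pos x₀ (M.defG.mem_iff.2 hx₀.le)
  have hg0 : g (γ₀ 0) < 0 := by
    rw [h₀.1]
    exact mul_neg_of_pos_of_neg (by positivity) ((M.inflow_iff hx₀).1 hξ₀).2
  have hev : ∀ᶠ u in nhdsWithin 0 (Ici (0 : ℝ)), g (γ₀ u) < 0 := by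
    have h1 := hgc.continuousAt.comp_continuousWithinAt (h₀.continuousOn 0 ⟨le_rfl, ht₀.le⟩)
    have := h1.eventually (Iio_mem_nhds hg0)
    rwa [nhdsWithin_Icc_eq_nhdsGE ht₀] at this
  obtain ⟨δ', hδ', hsub⟩ := mem_nhdsGE_iff_exists_Icc_subset.1 hev
  have hδ0 : 0 < min δ' t₀ := lt_min hδ' ht₀
  obtain ⟨ρ, hρ, htube⟩ := h₀.exists_tube hgc (a := 0) (b := min δ' t₀) le_rfl (min_le_right _ _)
    fun u hu => hsub ⟨hu.1, hu.2.trans (min_le_left _ _)⟩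
  refine ⟨min δ' t₀, ⟨hδ0, min_le_right _ _⟩, ρ, hρ, fun X t γ h hX ht hclose u hu => ?_⟩
  have hder : ∀ v ∈ Icc 0 t, HasDerivWithinAt (fun u => G (γ u).1) (g (γ v)) (Icc 0 t) v :=
    fun v hv => h.hasDerivWithinAt_comp_fst M.differentiable M.defG.differentiable hv
  have hanti : StrictAntiOn (fun u => G (γ u).1) (Icc 0 t) := by
    refine strictAntiOn_of_hasDerivWithinAt_neg (f' := fun v => g (γ v)) (convex_Icc 0 t)
      (fun v hv => (hder v hv).continuousWithinAt)
      (fun v hv => (hder v (interior_subset hv)).mono interior_subset) fun v hv => ?_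
    have hv' := interior_subset hv
    exact htube v ⟨hv'.1, hv'.2.trans ht⟩ _ (hclose v hv')
  have := hanti ⟨le_rfl, hu.1.le.trans hu.2⟩ ⟨hu.1.le, hu.2⟩ hu.1
  simpa [h.1, hX] using this

/-- Existence of nearby rays, as long as the given ray stays in the interior of the domain. -/
theorem exists_ray_near (M : IsMedium c F G Ω D) {x₀ ξ₀ : Space d} (hx₀ : G x₀ = 0)
    (hξ₀ : ξ₀ ∈ inflow c G x₀) {τ : ℝ} (hτ : 0 < τ) {γ₀ : ℝ → Phase d}
    (h₀ : IsRay c (x₀, ξ₀) τ γ₀) (hneg : ∀ u ∈ Ioc 0 τ, G (γ₀ u).1 < 0) :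
    ∃ K > 0, ∃ ε > 0, ∀ ζ ∈ inflow c G x₀, dist ζ ξ₀ < ε → ∃ γ, IsRay c (x₀, ζ) τ γ ∧
      (∀ u ∈ Ioc 0 τ, G (γ u).1 < 0) ∧ ∀ u ∈ Icc 0 τ, dist (γ u) (γ₀ u) ≤ K * dist ζ ξ₀ := by
  obtain ⟨K, hK, ε₁, hε₁, hdist⟩ := h₀.exists_dist_le M.contDiff
  obtain ⟨δ, hδ, ρ, hρ, henter⟩ := M.exists_entering hx₀ hξ₀ hτ h₀
  obtain ⟨ρ', hρ', htube⟩ := h₀.exists_tube (g := fun Z => G Z.1)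
    (M.defG.contDiff.continuous.comp continuous_fst) hδ.1.le le_rfl
    fun u hu => hneg u ⟨hδ.1.trans_le hu.1, hu.2⟩
  refine ⟨K, hK, min ε₁ (min ρ ρ' / K), lt_min hε₁ (div_pos (lt_min hρ hρ') hK),
    fun ζ hζ hζd => ?_⟩
  have hζK : K * dist ζ ξ₀ < min ρ ρ' := by
    have := (lt_div_iff₀ hK).1 (hζd.trans_le (min_le_right _ _))
    linarith
  have hd0 : dist (x₀, ζ) (x₀, ξ₀) = dist ζ ξ₀ := by simp [Prod.dist_eq]
  obtain ⟨t, ht, γ, hγ, hout⟩ := M.nonTrapping x₀ (M.defG.mem_iff.2 hx₀.le) ζ hζ.1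
  have hclose : ∀ u ∈ Icc 0 (min t τ), dist (γ u) (γ₀ u) ≤ K * dist ζ ξ₀ := by
    have := hdist _ _ γ (hγ.mono (min_le_left t τ)) (min_le_right t τ)
      (hd0 ▸ hζd.trans_le (min_le_left _ _))
    rwa [hd0] at this
  have hin : ∀ u ∈ Ioc 0 (min t τ), G (γ u).1 < 0 := by
    intro u hu
    rcases le_total u δ with huδ | huδ
    · have hut : u ≤ t := hu.2.trans (min_le_left t τ)
      exact henter _ u γ (hγ.mono hut) hx₀ huδ
        (fun v hv => (hclose v ⟨hv.1, hv.2.trans hu.2⟩).trans_lt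
          (hζK.trans_le (min_le_left _ _))) u ⟨hu.1, le_rfl⟩
    · exact htube u ⟨huδ, hu.2.trans (min_le_right _ _)⟩ _
        ((hclose u ⟨hu.1.le, hu.2⟩).trans_lt (hζK.trans_le (min_le_right _ _)))
  -- Non-trapping replaces an existence theorem: the nearby ray exists until it is outside `Ω`,
  -- which cannot have happened by time `τ`.
  have htτ : τ < t := by
    by_contra h
    have h' := not_lt.1 h
    exact hout (M.defG.mem_iff.2 (hin t ⟨ht, by rw [min_eq_left h']⟩).le)
  rw [min_eq_right htτ.le] at hclose hin
  exact ⟨γ, hγ.mono htτ.le, hin, hclose⟩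

/-- An inflowing ray reaches the boundary for a first time, and continues beyond it. -/
theorem exists_first_exit (M : IsMedium c F G Ω D) {x₀ ξ₀ : Space d} (hx₀ : G x₀ = 0)
    (hξ₀ : ξ₀ ∈ inflow c G x₀) : ∃ t γ, IsRay c (x₀, ξ₀) t γ ∧ ∃ T ∈ Ioo 0 t, G (γ T).1 = 0 ∧
      ∀ u ∈ Ioo 0 T, G (γ u).1 < 0 := by
  obtain ⟨t, ht, γ, hγ, hout⟩ := M.nonTrapping x₀ (M.defG.mem_iff.2 hx₀.le) ξ₀ hξ₀.1
  have hpos : 0 < G (γ t).1 := not_le.1 fun h => hout (M.defG.mem_iff.2 h)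
  obtain ⟨δ, hδ, ρ, hρ, henter⟩ := M.exists_entering hx₀ hξ₀ ht hγ
  have hin := henter _ δ γ (hγ.mono hδ.2) hx₀ le_rfl (fun u _ => by simpa)
  have hcont : ContinuousOn (fun u => G (γ u).1) (Icc δ t) :=
    (M.defG.contDiff.continuous.comp continuous_fst).comp_continuousOn
      (hγ.continuousOn.mono (Icc_subset_Icc_left hδ.1.le))
  obtain ⟨T, hT, hT0, hTneg⟩ := exists_first_zero hcont hδ.2 (hin δ ⟨hδ.1, le_rfl⟩) hpos.le
  refine ⟨t, γ, hγ, T, ⟨hδ.1.trans hT.1, lt_of_le_of_ne hT.2 ?_⟩, hT0, fun u hu => ?_⟩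
  · rintro rfl
    exact hpos.ne' hT0
  · rcases le_or_gt u δ with h | h
    · exact hin u ⟨hu.1, h⟩
    · exact hTneg u ⟨h.le, hu.2⟩

/-- A ray that enters the obstacle without leaving the domain meets the obstacle. -/
theorem exists_meetsObstacle (M : IsMedium c F G Ω D) {X : Phase d} {t : ℝ} {γ : ℝ → Phase d}
    (hγ : IsRay c X t γ) (ht : 0 ≤ t) (hX : 0 < F X.1)
    (hΩ : ∀ u ∈ Ioo 0 t, (γ u).1 ∉ frontier Ω) (hF : F (γ t).1 ≤ 0) :
    ∃ s ∈ Ioc 0 t, MeetsObstacle c Ω D X s (γ s) ∧ F (γ s).1 = 0 ∧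
      ∀ u ∈ Ico 0 s, 0 < F (γ u).1 := by
  have hcont : ContinuousOn (fun u => -F (γ u).1) (Icc 0 t) :=
    ((M.defF.contDiff.continuous.comp continuous_fst).comp_continuousOn hγ.continuousOn).neg
  obtain ⟨s, hs, hs0, hsneg⟩ := exists_first_zero hcont ht (by simpa [hγ.1] using hX) (by simpa)
  have hpos : ∀ u ∈ Ico 0 s, 0 < F (γ u).1 := fun u hu => by simpa using hsneg u hu
  have hs0' : F (γ s).1 = 0 := by simpa using hs0
  refine ⟨s, hs, ⟨hs.1, γ, hγ.mono hs.2, rfl, M.defF.mem_frontier_iff.2 hs0', fun u hu => ?_⟩,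
    hs0', hpos⟩
  rintro (h | h)
  · exact hΩ u ⟨hu.1, hu.2.trans_le hs.2⟩ h
  · exact (hpos u ⟨hu.1.le, hu.2⟩).ne' (M.defF.mem_frontier_iff.1 h)

theorem hamiltonian_reflect (M : IsMedium c F G Ω D) {x ξ : Space d} (hx : F x = 0)
    (h : hamiltonian c x ξ = 0) : hamiltonian c x (reflect F x ξ) = 0 := by
  rwa [hamiltonian, norm_reflect (M.defF.gradient_ne_zero x hx)]

/-- A ray that meets the obstacle exits after reflection. -/
theorem exists_exit_of_meetsObstacle (M : IsMedium c F G Ω D) {X Z : Phase d} {s : ℝ}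
    (hX : hamiltonian c X.1 X.2 = 0) (h : MeetsObstacle c Ω D X s Z) :
    ∃ r Y, Hits c (frontier Ω) (frontier Ω) (Z.1, reflect F Z.1 Z.2) r Y ∧
      exitData c F Ω D X = (s + r, Y) := by
  obtain ⟨hs, γ, hγ, rfl, hD, _⟩ := id h
  have hF := M.defF.mem_frontier_iff.1 hD
  have hGn := M.G_neg_of_F_nonpos hF.le
  have hH := M.hamiltonian_reflect hF
    (hγ.hamiltonian_eq_zero M.differentiable hX ⟨hs.le, le_rfl⟩)
  obtain ⟨t, ht, ρ, hρ, hout⟩ := M.nonTrapping _ (M.defG.mem_iff.2 hGn.le) _ hH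
  have hpos : 0 < G (ρ t).1 := not_le.1 fun h => hout (M.defG.mem_iff.2 h)
  obtain ⟨r, hr, hr0, hrneg⟩ := exists_first_zero (f := fun u => G (ρ u).1)
    ((M.defG.contDiff.continuous.comp continuous_fst).comp_continuousOn hρ.continuousOn) ht.le
    (by simpa [hρ.1] using hGn) hpos.le
  have hh : Hits c (frontier Ω) (frontier Ω) ((γ s).1, reflect F (γ s).1 (γ s).2) r (ρ r) :=
    ⟨hr.1, ρ, hρ.mono hr.2, rfl, M.defG.mem_frontier_iff.2 hr0, fun u hu hf =>
      (hrneg u ⟨hu.1.le, hu.2⟩).ne (M.defG.mem_frontier_iff.1 hf)⟩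
  exact ⟨r, ρ r, hh, Exits.exitData_eq M.contDiff M.disjoint_frontier
    (Or.inr ⟨s, γ s, r, h, hh, rfl⟩)⟩

end IsMedium

/-! ### The boundary of the smallest simply connected set -/

/-- A homeomorphism of a Banach space that moves one point to a nearby one and is supported in a
ball. -/
theorem exists_homeomorph_eq_add {E : Type*} [NormedAddCommGroup E] [NormedSpace ℝ E]
    [CompleteSpace E] (a v : E) {r : ℝ} (hv : ‖v‖ < r) :
    ∃ h : E ≃ₜ E, h a = a + v ∧ ∀ x, r ≤ dist x a → h x = x := by
  have hr : 0 < r := (norm_nonneg v).trans_lt hv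
  -- A tent-shaped translation: it differs from the identity by a map with Lipschitz constant `‖v‖ /
  -- r < 1`, hence is a homeomorphism.
  set φ : E → E := fun x => x + max 0 (1 - dist x a / r) • v with hφ
  have key : ∀ x y, |max 0 (1 - dist x a / r) - max 0 (1 - dist y a / r)| ≤ r⁻¹ * dist x y := by
    intro x y
    calc |max 0 (1 - dist x a / r) - max 0 (1 - dist y a / r)|
        ≤ |(1 - dist x a / r) - (1 - dist y a / r)| := by
          rw [max_comm 0, max_comm 0]
          exact abs_max_sub_max_le_abs _ _ _
      _ = r⁻¹ * |dist x a - dist y a| := by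
          rw [show (1 - dist x a / r) - (1 - dist y a / r) = -(r⁻¹ * (dist x a - dist y a)) by
            ring, abs_neg, abs_mul, abs_of_pos (inv_pos.2 hr)]
      _ ≤ r⁻¹ * dist x y := by
          gcongr
          exact abs_dist_sub_le x y a
  obtain ⟨k, hk⟩ : ∃ k : NNReal, (k : ℝ) = ‖v‖ / r := ⟨⟨‖v‖ / r, by positivity⟩, rfl⟩
  have happ : ApproximatesLinearOn φ ((ContinuousLinearEquiv.refl ℝ E : E ≃L[ℝ] E) : E →L[ℝ] E)
      univ k := by
    intro x _ y _
    have : φ x - φ y - ((ContinuousLinearEquiv.refl ℝ E : E ≃L[ℝ] E) : E →L[ℝ] E) (x - y) =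
        (max 0 (1 - dist x a / r) - max 0 (1 - dist y a / r)) • v := by
      simp only [hφ, ContinuousLinearEquiv.coe_refl, ContinuousLinearMap.coe_id', id_eq, sub_smul]
      abel
    rw [this, norm_smul, Real.norm_eq_abs, ← dist_eq_norm x y]
    have h := mul_le_mul_of_nonneg_right (key x y) (norm_nonneg v)
    refine h.trans (le_of_eq ?_)
    rw [hk]
    ring
  have hlt : Subsingleton E ∨ k <
      ‖((ContinuousLinearEquiv.refl ℝ E).symm : E →L[ℝ] E)‖₊⁻¹ := by
    rcases subsingleton_or_nontrivial E with hE | hE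
    · exact Or.inl hE
    · refine Or.inr ?_
      have h1 : ‖((ContinuousLinearEquiv.refl ℝ E).symm : E →L[ℝ] E)‖₊ = 1 := by
        ext
        simp
      rw [h1, inv_one, ← NNReal.coe_lt_coe]
      rw [hk]
      exact (div_lt_one hr).2 hv
  refine ⟨happ.toHomeomorph φ hlt, ?_, fun x hx => ?_⟩
  · change φ a = a + v
    simp [hφ]
  · change φ x = x
    have : 1 - dist x a / r ≤ 0 := by
      rw [sub_nonpos, le_div_iff₀ hr]
      linarith
    simp [hφ, max_eq_left this]

/-- Away from `closure B`, a homeomorphism `h` fixing `B` can move some `p ∈ C` to some `q ∉ C`.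
Then `h ⁻¹' C` is an admissible competitor without `p`, against minimality. -/
theorem frontier_subset_closure_of_isLeast {E : Type*} [NormedAddCommGroup E] [NormedSpace ℝ E]
    [CompleteSpace E] {B C : Set E} (hC : IsLeast {S | B ⊆ S ∧ IsSimplyConnected S} C) :
    frontier C ⊆ closure B := by
  intro x hx
  by_contra hxB
  obtain ⟨r, hr, hball⟩ := Metric.isOpen_iff.1 isClosed_closure.isOpen_compl x hxB
  obtain ⟨p, hp, hpd⟩ := Metric.mem_closure_iff.1 hx.1 (r / 4) (by positivity)
  have hx' : x ∈ closure Cᶜ := by rw [closure_compl]; exact hx.2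
  obtain ⟨q, hq, hqd⟩ := Metric.mem_closure_iff.1 hx' (r / 4) (by positivity)
  have hv : ‖q - p‖ < r / 2 := by
    rw [← dist_eq_norm]
    linarith [dist_triangle_left q p x]
  obtain ⟨h, hhp, hfix⟩ := exists_homeomorph_eq_add p (q - p) hv
  have hfixB : ∀ b ∈ B, h b = b := by
    refine fun b hb => hfix b ?_
    by_contra hlt
    have hbx : b ∈ Metric.ball x r := by
      rw [Metric.mem_ball]
      linarith [dist_triangle b p x, dist_comm x p]
    exact hball hbx (subset_closure hb)
  have hmem : h ⁻¹' C ∈ {S | B ⊆ S ∧ IsSimplyConnected S} :=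
    ⟨fun b hb => by
      rw [mem_preimage, hfixB b hb]
      exact hC.1.1 hb, h.isSimplyConnected_preimage.2 hC.1.2⟩
  have := hC.2 hmem hp
  rw [mem_preimage, hhp, add_sub_cancel] at this
  exact hq this

/-- Central projection of an open hemisphere onto a hyperplane. -/
theorem exists_homeomorph_hemisphere {V : Type*} [NormedAddCommGroup V] [InnerProductSpace ℝ V]
    {n : V} (hn : ‖n‖ = 1) {ρ : ℝ} (hρ : 0 < ρ) {S : Set V}
    (hS : ∀ ζ, ζ ∈ S ↔ ‖ζ‖ = ρ ∧ ⟪ζ, n⟫ < 0) : Nonempty (S ≃ₜ (ℝ ∙ n)ᗮ) := by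
  have hnn : ⟪n, n⟫ = 1 := by rw [real_inner_self_eq_norm_sq, hn, one_pow]
  have hw : ∀ w : (ℝ ∙ n)ᗮ, ⟪(w : V) - n, n⟫ = -1 := fun w => by
    rw [inner_sub_left, Submodule.mem_orthogonal_singleton_iff_inner_left.1 w.2, hnn]
    norm_num
  have hw0 : ∀ w : (ℝ ∙ n)ᗮ, 0 < ‖(w : V) - n‖ := fun w => norm_pos_iff.2 fun h => by
    have := hw w
    rw [h, inner_zero_left] at this
    norm_num at this
  refine ⟨{
    -- Rescale `ζ` until its `n`-component is `-1`, then translate by `n`.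
    toFun := fun ζ => ⟨(-⟪(ζ : V), n⟫)⁻¹ • (ζ : V) + n, ?_⟩
    invFun := fun w => ⟨(ρ / ‖(w : V) - n‖) • ((w : V) - n), ?_⟩
    left_inv := fun ζ => ?_
    right_inv := fun w => ?_
    continuous_toFun := ?_
    continuous_invFun := ?_ }⟩
  · have h := ((hS ζ).1 ζ.2).2.ne
    rw [Submodule.mem_orthogonal_singleton_iff_inner_left, inner_add_left, inner_smul_left, hnn]
    simp only [map_inv₀, conj_trivial]
    field_simp
    ring
  · rw [hS]
    constructor
    · rw [norm_smul, Real.norm_eq_abs, abs_of_pos (div_pos hρ (hw0 w)),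
        div_mul_cancel₀ _ (hw0 w).ne']
    · rw [inner_smul_left, hw]
      have := div_pos hρ (hw0 w)
      simpa using this
  · have h := (hS ζ).1 ζ.2
    have ha : 0 < (-⟪(ζ : V), n⟫)⁻¹ := inv_pos.2 (neg_pos.2 h.2)
    apply Subtype.ext
    simp only [add_sub_cancel_right]
    rw [norm_smul, Real.norm_eq_abs, abs_of_pos ha, h.1, smul_smul]
    have : ρ / ((-⟪(ζ : V), n⟫)⁻¹ * ρ) * (-⟪(ζ : V), n⟫)⁻¹ = 1 := by
      generalize (-⟪(ζ : V), n⟫)⁻¹ = a at ha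
      field_simp
    rw [this, one_smul]
  · apply Subtype.ext
    have hb := div_pos hρ (hw0 w)
    simp only [inner_smul_left, hw, conj_trivial, mul_neg, mul_one, neg_neg]
    rw [smul_smul, inv_mul_cancel₀ hb.ne', one_smul, sub_add_cancel]
  · refine Continuous.subtype_mk (((Continuous.inv₀ ?_ ?_).smul continuous_subtype_val).add
      continuous_const) _
    · exact (continuous_subtype_val.inner continuous_const).neg
    · exact fun ζ => (neg_pos.2 ((hS ζ).1 ζ.2).2).ne'
  · refine Continuous.subtype_mk ((Continuous.div continuous_const ?_ ?_).smul ?_) _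
    · exact (continuous_subtype_val.sub continuous_const).norm
    · exact fun w => (hw0 w).ne'
    · exact continuous_subtype_val.sub continuous_const

/-- The inflow set is an open hemisphere of radius `1 / c x₀`. Central projection carries the
minimality to a hyperplane, where the pushing homeomorphism is available. -/
theorem mem_closure_brokenDirections {c F G : Space d → ℝ} {Ω D : Set (Space d)}
    (M : IsMedium c F G Ω D) {x₀ : Space d} (hx₀ : G x₀ = 0) {C : Set (Space d)}
    (hC : IsSmallestSimplyConnected c G Ω D x₀ C) {ξ₀ : inflow c G x₀}
    (hξ₀ : ξ₀ ∈ frontier (Subtype.val ⁻¹' C : Set (inflow c G x₀))) :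
    (ξ₀ : Space d) ∈ closure (brokenDirections c G Ω D x₀) := by
  have hc := M.pos x₀ (M.defG.mem_iff.2 hx₀.le)
  have hS : ∀ ζ, ζ ∈ inflow c G x₀ ↔ ‖ζ‖ = (c x₀)⁻¹ ∧ ⟪ζ, unitNormal G x₀⟫ < 0 := by
    intro ζ
    have h1 : hamiltonian c x₀ ζ = 0 ↔ ‖ζ‖ = (c x₀)⁻¹ := by
      rw [hamiltonian, ← mul_eq_one_iff_eq_inv₀ hc.ne', ← sq_eq_sq₀ (by positivity) zero_le_one]
      constructor <;> intro h <;> linarith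
    rw [inflow, mem_ofPred_eq, h1, mul_neg_iff]
    have : ¬ c x₀ ^ 2 < 0 := not_lt.2 (by positivity)
    have : 0 < c x₀ ^ 2 := by positivity
    tauto
  obtain ⟨e⟩ := exists_homeomorph_hemisphere
    (norm_unitNormal (M.defG.gradient_ne_zero x₀ hx₀)) (inv_pos.2 hc) hS
  set f : (ℝ ∙ unitNormal G x₀)ᗮ → Space d := fun w => (e.symm w : Space d) with hf
  have hemb : Topology.IsEmbedding f := Topology.IsEmbedding.subtypeVal.comp e.symm.isEmbedding
  have hrange : range f = inflow c G x₀ := by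
    rw [hf, show (fun w => (e.symm w : Space d)) = Subtype.val ∘ e.symm from rfl,
      e.symm.surjective.range_comp, Subtype.range_coe]
  have himg : ∀ A ⊆ inflow c G x₀, f '' (f ⁻¹' A) = A := fun A hA =>
    image_preimage_eq_of_subset (hrange ▸ hA)
  have hleast : IsLeast {S | f ⁻¹' (brokenDirections c G Ω D x₀) ⊆ S ∧ IsSimplyConnected S}
      (f ⁻¹' C) := by
    refine ⟨⟨preimage_mono hC.1.1, ?_⟩, fun T hT => ?_⟩
    · rw [← hemb.isSimplyConnected_image, himg C hC.1.2.1]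
      exact hC.1.2.2
    · have : C ⊆ f '' T := hC.2 ⟨?_, ?_, hemb.isSimplyConnected_image.2 hT.2⟩
      · rw [← preimage_image_eq T hemb.injective]
        exact preimage_mono this
      · rw [← himg (brokenDirections c G Ω D x₀) (fun ζ hζ => hζ.1)]
        exact image_mono hT.1
      · rw [← hrange]
        exact image_subset_range f T
  have hfr : e ξ₀ ∈ frontier (f ⁻¹' C) := by
    have := e.symm.preimage_frontier (Subtype.val ⁻¹' C : Set (inflow c G x₀))
    rw [← preimage_comp] at this
    change e ξ₀ ∈ frontier ((Subtype.val ∘ e.symm) ⁻¹' C)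
    rw [← this, mem_preimage, e.symm_apply_apply]
    exact hξ₀
  have := map_mem_closure (t := brokenDirections c G Ω D x₀) hemb.continuous
    (frontier_subset_closure_of_isLeast hleast hfr) (fun w hw => hw)
  simpa [hf] using this

open Filter Topology

namespace IsMedium

variable {c F G : Space d → ℝ} {Ω D : Set (Space d)} {x₀ ξ₀ : Space d} {γ₀ : ℝ → Phase d}

/-! ### Transversal rays and rays that miss the obstacle -/

/-- Directions close to that of a ray that enters the interior of the obstacle are broken. -/
theorem brokenDirections_mem_nhdsWithin (M : IsMedium c F G Ω D) (hx₀ : G x₀ = 0)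
    (hξ₀ : ξ₀ ∈ inflow c G x₀) {τ : ℝ} (hτ : 0 < τ) (h₀ : IsRay c (x₀, ξ₀) τ γ₀)
    (hneg : ∀ u ∈ Ioc 0 τ, G (γ₀ u).1 < 0) (hF : F (γ₀ τ).1 < 0) :
    brokenDirections c G Ω D x₀ ∈ 𝓝[inflow c G x₀] ξ₀ := by
  obtain ⟨K, hK, ε, hε, hnear⟩ := M.exists_ray_near hx₀ hξ₀ hτ h₀ hneg
  obtain ⟨ρ, hρ, htube⟩ := h₀.exists_tube (g := fun Z => F Z.1)
    (M.defF.contDiff.continuous.comp continuous_fst) (a := τ) (b := τ) hτ.le le_rfl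
    (fun u hu => by rwa [le_antisymm hu.2 hu.1])
  refine Metric.mem_nhdsWithin_iff.2 ⟨min ε (ρ / K), lt_min hε (div_pos hρ hK), ?_⟩
  rintro ζ ⟨hζd, hζ⟩
  rw [Metric.mem_ball] at hζd
  obtain ⟨γ, hγ, hγG, hγd⟩ := hnear ζ hζ (hζd.trans_le (min_le_left _ _))
  have hlt := htube τ ⟨le_rfl, le_rfl⟩ (γ τ) ((hγd τ ⟨hτ.le, le_rfl⟩).trans_lt (by
    have := (lt_div_iff₀ hK).1 (hζd.trans_le (min_le_right _ _))
    linarith))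
  have hno : ∀ u ∈ Ioo 0 τ, (γ u).1 ∉ frontier Ω := fun u hu h =>
    (hγG u ⟨hu.1, hu.2.le⟩).ne (M.defG.mem_frontier_iff.1 h)
  obtain ⟨s, hs, -, hs0, -⟩ := M.exists_meetsObstacle hγ hτ.le (M.F_pos_of_G_nonneg hx₀.ge) hno
    hlt.le
  exact ⟨hζ, s, γ s, hs.1, γ, hγ.mono hs.2, rfl, M.defF.mem_frontier_iff.2 hs0,
    fun u hu => hno u ⟨hu.1, hu.2.trans_le hs.2⟩⟩

/-- The travel time jumps at a limit of broken directions whose ray misses the obstacle. -/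
theorem not_continuousWithinAt_travelTime (M : IsMedium c F G Ω D) (hx₀ : G x₀ = 0)
    {t T : ℝ} (h₀ : IsRay c (x₀, ξ₀) t γ₀) (hT : T ∈ Ioo 0 t) (hT0 : G (γ₀ T).1 = 0)
    (hneg : ∀ u ∈ Ioo 0 T, G (γ₀ u).1 < 0) (hF : ∀ u ∈ Ioo 0 T, 0 < F (γ₀ u).1)
    (hcl : ξ₀ ∈ closure (brokenDirections c G Ω D x₀)) :
    ¬ ContinuousWithinAt (travelTime c F Ω D x₀) (inflow c G x₀) ξ₀ := by
  intro hcont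
  have hFx₀ := M.F_pos_of_G_nonneg hx₀.ge
  have hTT : travelTime c F Ω D x₀ ξ₀ = T := by
    rw [travelTime, Exits.exitData_eq M.contDiff M.disjoint_frontier (t := T) (Y := γ₀ T)]
    refine Or.inl ⟨hT.1, γ₀, h₀.mono hT.2.le, rfl, M.defG.mem_frontier_iff.2 hT0, fun u hu => ?_⟩
    rintro (h | h)
    · exact (hneg u hu).ne (M.defG.mem_frontier_iff.1 h)
    · exact (hF u hu).ne' (M.defF.mem_frontier_iff.1 h)
  have hFc : Continuous fun Z : Phase d => -F Z.1 :=
    (M.defF.contDiff.continuous.comp continuous_fst).neg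
  have hev : ∀ᶠ u in 𝓝[≥] T, -F (γ₀ u).1 < 0 := by
    have h1 := hFc.continuousAt.comp_continuousWithinAt
      ((h₀.continuousOn T ⟨hT.1.le, hT.2.le⟩).mono (Icc_subset_Icc_left hT.1.le))
    have := h1.eventually (Iio_mem_nhds (neg_lt_zero.2 (M.F_pos_of_G_nonneg hT0.ge)))
    rwa [nhdsWithin_Icc_eq_nhdsGE hT.2] at this
  obtain ⟨T₁, hT₁, hsub⟩ := mem_nhdsGE_iff_exists_Icc_subset.1 hev
  -- `F > 0` near `∂Ω`, so the free ray keeps off the obstacle on `[0, T']` with `T' > T`.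
  set T' := min T₁ t
  have hTT' : T < T' := lt_min hT₁ hT.2
  obtain ⟨ρ, hρ, htube⟩ := h₀.exists_tube hFc (a := 0) (b := T') le_rfl (min_le_right _ _)
    (fun u hu => by
      rcases lt_or_ge u T with h | h
      · rcases hu.1.eq_or_lt with rfl | h'
        · simpa [h₀.1] using hFx₀
        · exact neg_lt_zero.2 (hF u ⟨h', h⟩)
      · exact hsub ⟨h, hu.2.trans (min_le_left _ _)⟩)
  obtain ⟨K, hK, δ, hδ, hdist⟩ := (h₀.mono (min_le_right T₁ t)).exists_dist_le M.contDiff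
  have hlt : ∀ᶠ ζ in 𝓝[inflow c G x₀] ξ₀, travelTime c F Ω D x₀ ζ < T' :=
    hcont.eventually (Iio_mem_nhds (by rwa [hTT]))
  have hev2 : ∀ᶠ ζ in 𝓝 ξ₀, ζ ∈ inflow c G x₀ → travelTime c F Ω D x₀ ζ < T' :=
    eventually_nhdsWithin_iff.1 hlt
  have hball : ∀ᶠ ζ in 𝓝 ξ₀, dist ζ ξ₀ < min δ (ρ / K) :=
    Metric.ball_mem_nhds ξ₀ (lt_min hδ (div_pos hρ hK))
  obtain ⟨ζ, ⟨hζ, t', Z', ht', γ, hγ, rfl, hZ', hno⟩, h1, h2⟩ :=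
    ((mem_closure_iff_frequently.1 hcl).and_eventually (hev2.and hball)).exists
  -- The contact in `brokenDirections` need not be the first one; the reflection takes place at the
  -- first.
  obtain ⟨s, hs, hmeet, hs0, -⟩ := M.exists_meetsObstacle hγ ht'.le hFx₀ hno
    (M.defF.mem_frontier_iff.1 hZ').le
  obtain ⟨r, Y, hr, hY⟩ := M.exists_exit_of_meetsObstacle hζ.1 hmeet
  have hlt' := h1 hζ
  rw [travelTime, hY] at hlt'
  have hsT : s ≤ T' := by
    have := hr.1
    simp only at hlt'
    linarith
  have hd0 : dist (x₀, ζ) (x₀, ξ₀) = dist ζ ξ₀ := by simp [Prod.dist_eq]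
  have hd := hdist _ s γ (hγ.mono hs.2) hsT (hd0 ▸ h2.trans_le (min_le_left _ _)) s ⟨hs.1.le, le_rfl⟩
  rw [hd0] at hd
  have := htube s ⟨hs.1.le, hsT⟩ (γ s) (hd.trans_lt (by
    have := (lt_div_iff₀ hK).1 (h2.trans_le (min_le_right _ _))
    linarith))
  rw [hs0] at this
  simp at this

/-! ### Tangential rays -/

/-- Reflection is the identity on tangential covectors, so the broken ray is the free ray. Later
contacts with `D` do not matter, since a ray is broken only once. -/
theorem exitData_eq_of_tangential (M : IsMedium c F G Ω D) {t T s : ℝ}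
    (h₀ : IsRay c (x₀, ξ₀) t γ₀) (hTt : T ≤ t) (hT0 : G (γ₀ T).1 = 0)
    (hneg : ∀ u ∈ Ioo 0 T, G (γ₀ u).1 < 0) (hs : s ∈ Ioo 0 T)
    (hmeet : MeetsObstacle c Ω D (x₀, ξ₀) s (γ₀ s))
    (htan : ⟪unitNormal F (γ₀ s).1, (γ₀ s).2⟫ = 0) :
    exitData c F Ω D (x₀, ξ₀) = (T, γ₀ T) := by
  refine Exits.exitData_eq M.contDiff M.disjoint_frontier
    (Or.inr ⟨s, γ₀ s, T - s, hmeet, ⟨sub_pos.2 hs.2, fun u => γ₀ (s + u), ?_, by simp,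
      M.defG.mem_frontier_iff.2 hT0, fun u hu h => ?_⟩, by ring⟩)
  · have : reflect F (γ₀ s).1 (γ₀ s).2 = (γ₀ s).2 := by simp [reflect, htan]
    rw [this]
    exact (h₀.mono hTt).shift hs.1.le
  · exact (hneg (s + u) ⟨by linarith [hu.1, hs.1], by linarith [hu.2]⟩).ne
      (M.defG.mem_frontier_iff.1 h)

theorem norm_reflect_sub {F : Space d → ℝ} {x : Space d} (h : gradient F x ≠ 0) (ξ : Space d) :
    ‖reflect F x ξ - ξ‖ = 2 * |⟪unitNormal F x, ξ⟫| := by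
  rw [reflect, sub_sub_cancel_left, norm_neg, norm_smul, norm_unitNormal h, Real.norm_eq_abs,
    abs_mul, abs_two, mul_one]

/-- If the exit data are Lipschitz at the direction of a tangential ray, then nearby rays meet the
obstacle almost tangentially. -/
theorem exists_abs_inner_unitNormal_le (M : IsMedium c F G Ω D) {t T s : ℝ}
    (h₀ : IsRay c (x₀, ξ₀) t γ₀) (hT : T ∈ Ioo 0 t) (hs : 0 < s)
    (hexit : exitData c F Ω D (x₀, ξ₀) = (T, γ₀ T)) {L : ℝ}
    (hL : ∀ᶠ ζ in 𝓝[inflow c G x₀] ξ₀,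
      ‖exitData c F Ω D (x₀, ζ) - exitData c F Ω D (x₀, ξ₀)‖ ≤ L * ‖ζ - ξ₀‖) :
    ∃ L' ≥ 0, ∀ᶠ ζ in 𝓝[inflow c G x₀] ξ₀, ∀ t₁ Z, MeetsObstacle c Ω D (x₀, ζ) t₁ Z →
      s / 2 ≤ t₁ → t₁ ≤ T → |⟪unitNormal F Z.1, Z.2⟫| ≤ L' * dist ζ ξ₀ := by
  obtain ⟨K, hK, δ, hδ, hdist⟩ := h₀.exists_dist_le M.contDiff
  obtain ⟨K₁, hK₁, hLip⟩ := h₀.exists_dist_le_mul_abs M.contDiff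
  obtain ⟨K₂, hK₂, δ₂, hδ₂, hdist₂⟩ :=
    ((h₀.mono hT.2.le).reverse M.differentiable).exists_dist_le M.contDiff
  -- `L` may be negative.
  set L₁ := max L 0 with hL₁
  have hL₁0 : 0 ≤ L₁ := le_max_right _ _
  refine ⟨K₂ * L₁ + K₁ * L₁ + K, by positivity, ?_⟩
  have hsmall : ∀ᶠ ζ in 𝓝[inflow c G x₀] ξ₀,
      dist ζ ξ₀ < δ ∧ L₁ * dist ζ ξ₀ < min δ₂ (s / 2) := by
    have hcd : Continuous fun ζ => dist ζ ξ₀ := continuous_id.dist continuous_const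
    refine nhdsWithin_le_nhds (Filter.Eventually.and ?_ ?_)
    · exact Metric.ball_mem_nhds ξ₀ hδ
    · refine (continuous_const.mul hcd).continuousAt.eventually_lt continuousAt_const ?_
      simpa using ⟨hδ₂, hs⟩
  filter_upwards [hL, hsmall, self_mem_nhdsWithin] with ζ hζL hζs hζ t₁ Z hmeet ht₁ ht₁T
  obtain ⟨r, Y, hr, hY⟩ := M.exists_exit_of_meetsObstacle hζ.1 hmeet
  obtain ⟨ht₁0, γ, hγ, rfl, hZ, -⟩ := hmeet
  obtain ⟨hr0, ρ, hρ, rfl, -, -⟩ := hr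
  set e := dist ζ ξ₀ with he
  have hLe : ‖exitData c F Ω D (x₀, ζ) - exitData c F Ω D (x₀, ξ₀)‖ ≤ L₁ * e := by
    rw [he, dist_eq_norm]
    exact hζL.trans (mul_le_mul_of_nonneg_right (le_max_left _ _) (norm_nonneg _))
  rw [hY, hexit, ← dist_eq_norm, Prod.dist_eq, max_le_iff] at hLe
  simp only [Real.dist_eq] at hLe
  obtain ⟨hLt, hLY⟩ := hLe
  have habs := abs_le.1 hLt
  have hs2 : L₁ * e < s / 2 := hζs.2.trans_le (min_le_right _ _)
  -- From `|t₁ + r - T| < s / 2 ≤ t₁`; the reference ray can then be run backwards from `T` for the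
  -- whole time `r`.
  have hrT : r ≤ T := by linarith
  have hfst : ∀ {A B : Phase d}, dist A.2 B.2 ≤ dist A B := fun {A B} => le_max_right _ _
  have hback : dist (reflect F (γ t₁).1 (γ t₁).2) (γ₀ (T - r)).2 ≤ K₂ * (L₁ * e) := by
    have hflip : dist ((ρ r).1, -(ρ r).2) ((γ₀ T).1, -(γ₀ T).2) = dist (ρ r) (γ₀ T) := by
      simp [Prod.dist_eq]
    have h1 := hdist₂ _ r _ (hρ.reverse M.differentiable) hrT
      (by rw [hflip]; exact hLY.trans_lt (hζs.2.trans_le (min_le_left _ _))) r ⟨hr0.le, le_rfl⟩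
    rw [hflip] at h1
    have h2 := (hfst.trans h1).trans (mul_le_mul_of_nonneg_left hLY hK₂.le)
    simpa [hρ.1] using h2
  have hmid : dist (γ₀ (T - r)).2 (γ₀ t₁).2 ≤ K₁ * (L₁ * e) := by
    refine (hfst.trans (hLip (T - r) ⟨by linarith, by linarith [hT.2]⟩ t₁
      ⟨ht₁0.le, ht₁T.trans hT.2.le⟩)).trans (mul_le_mul_of_nonneg_left ?_ hK₁)
    rw [abs_sub_comm]
    convert hLt using 2
    ring
  have hfwd : dist (γ₀ t₁).2 (γ t₁).2 ≤ K * e := by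
    have hd0 : dist (x₀, ζ) (x₀, ξ₀) = e := by simp [Prod.dist_eq, he]
    have := hdist _ t₁ γ hγ (ht₁T.trans hT.2.le) (hd0 ▸ hζs.1) t₁ ⟨ht₁0.le, le_rfl⟩
    rw [hd0, dist_comm] at this
    exact hfst.trans this
  -- The reflected covector is compared with the incident one through the covectors of `γ₀` at `T -
  -- r` and `t₁`.
  have hsum : 2 * |⟪unitNormal F (γ t₁).1, (γ t₁).2⟫| ≤
      K₂ * (L₁ * e) + K₁ * (L₁ * e) + K * e := by
    rw [← norm_reflect_sub (M.defF.gradient_ne_zero _ (M.defF.mem_frontier_iff.1 hZ)),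
      ← dist_eq_norm]
    exact (dist_triangle4 _ _ _ _).trans (add_le_add_three hback hmid hfwd)
  have := abs_nonneg ⟪unitNormal F (γ t₁).1, (γ t₁).2⟫
  nlinarith

/-- If the position at time `s` of the ray depends on the initial covector in a direction normal
to the obstacle, then there are inflowing rays that enter the obstacle at linear rate. -/
theorem exists_entering_directions (M : IsMedium c F G Ω D) (hx₀ : G x₀ = 0)
    (hξ₀ : ξ₀ ∈ inflow c G x₀) {s τ : ℝ} (hs : 0 < s) (hsτ : s ≤ τ)
    (h₀ : IsRay c (x₀, ξ₀) τ γ₀) (hF0 : F (γ₀ s).1 = 0)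
    (hv : ∃ v, ⟪unitNormal F (γ₀ s).1, fderiv ℝ (fun η => (flow c s (x₀, η)).1) ξ₀ v⟫ ≠ 0) :
    ∃ κ > 0, ∃ A ≥ 0, ∀ᶠ ε in 𝓝[>] (0 : ℝ), ∃ ζ ∈ inflow c G x₀, ∃ s', dist ζ ξ₀ ≤ A * ε ∧
      |s' - s| ≤ A * ε ∧ ∀ γ, IsRay c (x₀, ζ) τ γ → s' ≤ τ → F (γ s').1 ≤ -κ * ε := by
  have hgF := M.defF.gradient_ne_zero _ hF0
  have hgF' : 0 < ‖gradient F (γ₀ s).1‖ := norm_pos_iff.2 hgF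
  obtain ⟨v, hv⟩ : ∃ v, ⟪gradient F (γ₀ s).1,
      fderiv ℝ (fun η => (flow c s (x₀, η)).1) ξ₀ v⟫ < 0 := by
    obtain ⟨v, hv⟩ := hv
    have hv' : ⟪gradient F (γ₀ s).1, fderiv ℝ (fun η => (flow c s (x₀, η)).1) ξ₀ v⟫ ≠ 0 := by
      rw [gradient_eq_smul_unitNormal hgF, real_inner_smul_left]
      exact mul_ne_zero hgF'.ne' hv
    rcases hv'.lt_or_gt with h | h
    · exact ⟨v, h⟩
    · exact ⟨-v, by rw [map_neg, inner_neg_right]; linarith⟩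
  have hflow : (flow c s (x₀, ξ₀)) = γ₀ s := flow_eq M.contDiff (h₀.mono hsτ) hs.le
  -- Without differentiability `fderiv` would be `0`, against `hv`.
  have hdiff : DifferentiableAt ℝ (fun η => (flow c s (x₀, η)).1) ξ₀ := by
    by_contra h
    rw [fderiv_zero_of_not_differentiableAt h] at hv
    simp at hv
  have hc := M.pos x₀ (M.defG.mem_iff.2 hx₀.le)
  have hξ0 : 0 < ‖ξ₀‖ := by
    refine norm_pos_iff.2 fun h => ?_
    have := ((M.inflow_iff hx₀).1 hξ₀).2
    simp [h] at this
  set m := ⟪gradient F (γ₀ s).1, fderiv ℝ (fun η => (flow c s (x₀, η)).1) ξ₀ v⟫ with hm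
  have hline : HasDerivAt (fun ε : ℝ => ξ₀ + ε • v) v 0 := by
    simpa using ((hasDerivAt_id (0 : ℝ)).smul_const v).const_add ξ₀
  have hder : HasDerivAt (fun ε : ℝ => F (flow c s (x₀, ξ₀ + ε • v)).1) m 0 := by
    have h1 : HasFDerivAt (fun η => (flow c s (x₀, η)).1)
        (fderiv ℝ (fun η => (flow c s (x₀, η)).1) ξ₀) (ξ₀ + (0 : ℝ) • v) := by
      simpa using hdiff.hasFDerivAt
    have h2 := h1.comp_hasDerivAt (0 : ℝ) hline
    have h3 : HasFDerivAt F (fderiv ℝ F (γ₀ s).1) (flow c s (x₀, ξ₀ + (0 : ℝ) • v)).1 := by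
      rw [zero_smul, add_zero, hflow]
      exact (M.defF.differentiable _).hasFDerivAt
    have h4 := h3.comp_hasDerivAt (0 : ℝ) h2
    rw [hm, inner_gradient_left]
    exact h4
  have hdec : ∀ᶠ ε in 𝓝[>] (0 : ℝ), F (flow c s (x₀, ξ₀ + ε • v)).1 ≤ -(-m / 2) * ε := by
    have h1 := (hasDerivAt_iff_tendsto_slope.1 hder).mono_left
      (nhdsWithin_mono (s := Ioi 0) 0 (fun ε (hε : 0 < ε) => hε.ne'))
    filter_upwards [h1.eventually (Iio_mem_nhds (show m < m / 2 by linarith)),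
      self_mem_nhdsWithin] with ε hε (hε0 : 0 < ε)
    rw [slope_def_field, sub_zero, zero_smul, add_zero, hflow, hF0, sub_zero,
      div_lt_iff₀ hε0] at hε
    linarith
  have hnormal : ∀ᶠ ε in 𝓝[>] (0 : ℝ), ⟪gradient G x₀, ξ₀ + ε • v⟫ < 0 ∧
      ‖ξ₀‖ / 2 < ‖ξ₀ + ε • v‖ := by
    have hlc : Continuous fun ε : ℝ => ξ₀ + ε • v := by fun_prop
    refine nhdsWithin_le_nhds (Filter.Eventually.and ?_ ?_)
    · refine (continuous_const.inner hlc).continuousAt.eventually_lt continuousAt_const ?_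
      simpa using ((M.inflow_iff hx₀).1 hξ₀).2
    · refine continuousAt_const.eventually_lt hlc.norm.continuousAt ?_
      simpa using hξ0
  refine ⟨-m / 2, by linarith, max (4 * ‖v‖) (‖v‖ / ‖ξ₀‖ * s), by positivity, ?_⟩
  filter_upwards [hdec, hnormal, self_mem_nhdsWithin] with ε hε1 hε2 (hε0 : 0 < ε)
  obtain ⟨hε2, hε3⟩ := hε2
  set η := ξ₀ + ε • v with hη
  have hη0 : 0 < ‖η‖ := by linarith
  set b := ‖η‖ / ‖ξ₀‖ with hb
  have hb0 : 0 < b := div_pos hη0 hξ0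
  have hb2 : 1 / 2 < b := by
    rw [hb, lt_div_iff₀ hξ0]
    linarith
  have hηξ : ‖η - ξ₀‖ = ε * ‖v‖ := by
    rw [hη, add_sub_cancel_left, norm_smul, Real.norm_eq_abs, abs_of_pos hε0]
  have hb1 : |b - 1| ≤ ε * ‖v‖ / ‖ξ₀‖ := by
    rw [hb, div_sub_one hξ0.ne', abs_div, abs_of_pos hξ0, ← hηξ]
    gcongr
    exact abs_norm_sub_norm_le _ _
  have hζnorm : ‖b⁻¹ • η‖ = ‖ξ₀‖ := by
    rw [norm_smul, Real.norm_eq_abs, abs_of_pos (inv_pos.2 hb0), hb]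
    field_simp
  refine ⟨b⁻¹ • η, ?_, b * s, ?_, ?_, fun γ hγ hτ => ?_⟩
  · rw [M.inflow_iff hx₀, hamiltonian, hζnorm, real_inner_smul_right]
    exact ⟨hξ₀.1, mul_neg_of_pos_of_neg (inv_pos.2 hb0) hε2⟩
  · have h1 : b⁻¹ • η - ξ₀ = b⁻¹ • ((η - ξ₀) - (b - 1) • ξ₀) := by
      rw [sub_smul, one_smul, sub_sub_sub_cancel_right, smul_sub, smul_smul,
        inv_mul_cancel₀ hb0.ne', one_smul]
    have h2 : ‖(η - ξ₀) - (b - 1) • ξ₀‖ ≤ 2 * (ε * ‖v‖) := by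
      refine (norm_sub_le _ _).trans ?_
      rw [hηξ, norm_smul, Real.norm_eq_abs]
      have := (le_div_iff₀ hξ0).1 hb1
      linarith
    have h3 : b⁻¹ ≤ 2 := by
      rw [inv_le_comm₀ hb0 two_pos]
      linarith
    rw [dist_eq_norm, h1, norm_smul, Real.norm_eq_abs, abs_of_pos (inv_pos.2 hb0)]
    calc b⁻¹ * ‖(η - ξ₀) - (b - 1) • ξ₀‖ ≤ 2 * (2 * (ε * ‖v‖)) := by gcongr
      _ = 4 * ‖v‖ * ε := by ring
      _ ≤ _ := by gcongr; exact le_max_left _ _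
  · calc |b * s - s| = |b - 1| * s := by
          rw [← sub_one_mul, abs_mul, abs_of_pos hs]
      _ ≤ ε * ‖v‖ / ‖ξ₀‖ * s := by gcongr
      _ = ‖v‖ / ‖ξ₀‖ * s * ε := by ring
      _ ≤ _ := by gcongr; exact le_max_right _ _
  · have hsc := (hγ.mono hτ).scale M.differentiable hb0
    rw [mul_div_cancel_left₀ s hb0.ne', smul_smul, mul_inv_cancel₀ hb0.ne', one_smul] at hsc
    rw [flow_eq M.contDiff hsc hs.le] at hε1
    exact hε1

end IsMedium

/-! ### The rate of `n · ξ` along rays, and the contradiction at a tangency. -/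

theorem contDiffOn_unitNormal {F : Space d → ℝ} {D : Set (Space d)}
    (h : IsC2DefiningFunction F D) : ContDiffOn ℝ 1 (unitNormal F) {x | gradient F x ≠ 0} := by
  have hg : ContDiff ℝ 1 (gradient F) := by
    exact_mod_cast contDiff_gradient (n := 2) (m := 1) h.contDiff (by norm_num)
  exact ((hg.contDiffOn.norm ℝ fun x hx => hx).inv fun x hx => norm_ne_zero_iff.2 hx).smul
    hg.contDiffOn

/-- The derivative along the Hamiltonian field of `n · ξ`, where `n` is the unit normal of the
obstacle. -/
noncomputable def normalRate (c F : Space d → ℝ) (Z : Phase d) : ℝ :=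
  ⟪unitNormal F Z.1, (hamField c Z).2⟫ +
    ⟪fderiv ℝ (unitNormal F) Z.1 (hamField c Z).1, Z.2⟫

theorem IsRay.hasDerivWithinAt_inner_unitNormal {c F : Space d → ℝ} {D : Set (Space d)}
    (hF : IsC2DefiningFunction F D) {X : Phase d} {t : ℝ} {γ : ℝ → Phase d} (h : IsRay c X t γ)
    {u : ℝ} (hu : u ∈ Icc 0 t) (hg : gradient F (γ u).1 ≠ 0) :
    HasDerivWithinAt (fun u => ⟪unitNormal F (γ u).1, (γ u).2⟫) (normalRate c F (γ u))
      (Icc 0 t) u := by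
  have hopen : IsOpen {x | gradient F x ≠ 0} :=
    isOpen_ne_fun hF.continuous_gradient continuous_const
  have hd : DifferentiableAt ℝ (unitNormal F) (γ u).1 :=
    ((contDiffOn_unitNormal hF).differentiableOn one_ne_zero).differentiableAt
      (hopen.mem_nhds hg)
  have h1 := (ContinuousLinearMap.fst ℝ (Space d) (Space d)).hasFDerivAt.comp_hasDerivWithinAt u
    (h.2 u hu)
  have h2 := (ContinuousLinearMap.snd ℝ (Space d) (Space d)).hasFDerivAt.comp_hasDerivWithinAt u
    (h.2 u hu)
  exact (hd.hasFDerivAt.comp_hasDerivWithinAt u h1).inner ℝ h2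

theorem continuousAt_normalRate {c F : Space d → ℝ} (hc : ContDiff ℝ 3 c) {D : Set (Space d)}
    (hF : IsC2DefiningFunction F D) {Z : Phase d} (hZ : gradient F Z.1 ≠ 0) :
    ContinuousAt (normalRate c F) Z := by
  have hopen : IsOpen {x | gradient F x ≠ 0} :=
    isOpen_ne_fun hF.continuous_gradient continuous_const
  have hmem := hopen.mem_nhds (show Z.1 ∈ {x | gradient F x ≠ 0} from hZ)
  have hn : ContinuousAt (unitNormal F) Z.1 :=
    (contDiffOn_unitNormal hF).continuousOn.continuousAt hmem
  have hn' : ContinuousAt (fderiv ℝ (unitNormal F)) Z.1 :=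
    ((contDiffOn_unitNormal hF).continuousOn_fderiv_of_isOpen hopen le_rfl).continuousAt hmem
  have hV := (contDiff_hamField hc).continuous.continuousAt (x := Z)
  have hn1 : ContinuousAt (fun Z : Phase d => unitNormal F Z.1) Z :=
    ContinuousAt.comp (f := Prod.fst) hn continuousAt_fst
  have hn2 : ContinuousAt (fun Z : Phase d => fderiv ℝ (unitNormal F) Z.1) Z :=
    ContinuousAt.comp (f := Prod.fst) hn' continuousAt_fst
  exact (hn1.inner (𝕜 := ℝ) hV.snd).add ((hn2.clm_apply hV.fst).inner (𝕜 := ℝ) continuousAt_snd)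

/-- Near a tangency at which `n · ξ` has nonzero rate of change, this rate is positive if the
ray comes from outside the obstacle. -/
theorem IsMedium.normalRate_pos {c F G : Space d → ℝ} {Ω D : Set (Space d)}
    (M : IsMedium c F G Ω D) {X : Phase d} {s : ℝ} (hs : 0 < s) {γ : ℝ → Phase d}
    (h : IsRay c X s γ) (hF0 : F (γ s).1 = 0) (hpos : ∀ u ∈ Ico 0 s, 0 < F (γ u).1)
    (htan : ⟪unitNormal F (γ s).1, (γ s).2⟫ = 0) (hne : normalRate c F (γ s) ≠ 0) :
    0 < normalRate c F (γ s) := by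
  -- With a negative rate, `n · ξ` would be positive just before `s`; then `F` would increase to
  -- `0`, so the ray would come from inside the obstacle.
  refine hne.lt_or_gt.resolve_left fun hlt => ?_
  have hg := M.defF.gradient_ne_zero _ hF0
  have hγs : ContinuousWithinAt γ (Icc 0 s) s := h.continuousOn s ⟨hs.le, le_rfl⟩
  have hcG : 0 < c (γ s).1 :=
    M.pos _ (M.defG.mem_iff.2 (M.G_neg_of_F_nonpos hF0.le).le)
  have hev : ∀ᶠ Z in 𝓝 (γ s), normalRate c F Z < 0 ∧ gradient F Z.1 ≠ 0 ∧ 0 < c Z.1 :=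
    ((continuousAt_normalRate M.contDiff M.defF hg).eventually (Iio_mem_nhds hlt)).and
      (((M.defF.continuous_gradient.comp continuous_fst).continuousAt.eventually_ne hg).and
        ((M.contDiff.continuous.comp continuous_fst).continuousAt.eventually (Ioi_mem_nhds hcG)))
  have hev' := hγs.eventually hev
  rw [nhdsWithin_Icc_eq_nhdsLE hs] at hev'
  obtain ⟨l, hl, hsub⟩ := mem_nhdsLE_iff_exists_Icc_subset.1 hev'
  set a := max l 0
  have ha : a < s := max_lt hl hs
  have ha0 : 0 ≤ a := le_max_right _ _
  have hP : ∀ u ∈ Icc a s, normalRate c F (γ u) < 0 ∧ gradient F (γ u).1 ≠ 0 ∧ 0 < c (γ u).1 :=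
    fun u hu => hsub ⟨(le_max_left _ _).trans hu.1, hu.2⟩
  have hIcc : Icc a s ⊆ Icc 0 s := Icc_subset_Icc_left ha0
  have hq : ∀ u ∈ Icc a s, HasDerivWithinAt (fun u => ⟪unitNormal F (γ u).1, (γ u).2⟫)
      (normalRate c F (γ u)) (Icc a s) u := fun u hu =>
    (h.hasDerivWithinAt_inner_unitNormal M.defF (hIcc hu) (hP u hu).2.1).mono hIcc
  have hanti : StrictAntiOn (fun u => ⟪unitNormal F (γ u).1, (γ u).2⟫) (Icc a s) :=
    strictAntiOn_of_hasDerivWithinAt_neg (convex_Icc a s)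
      (fun u hu => (hq u hu).continuousWithinAt)
      (fun u hu => (hq u (interior_subset hu)).mono interior_subset)
      fun u hu => (hP u (interior_subset hu)).1
  have hqpos : ∀ u ∈ Ico a s, 0 < ⟪unitNormal F (γ u).1, (γ u).2⟫ := fun u hu => by
    have := hanti ⟨hu.1, hu.2.le⟩ ⟨ha.le, le_rfl⟩ hu.2
    simpa [htan] using this
  have hFd : ∀ u ∈ Icc a s, HasDerivWithinAt (fun u => F (γ u).1)
      (c (γ u).1 ^ 2 * ⟪gradient F (γ u).1, (γ u).2⟫) (Icc a s) u := fun u hu =>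
    (h.hasDerivWithinAt_comp_fst M.differentiable M.defF.differentiable (hIcc hu)).mono hIcc
  have hmono : StrictMonoOn (fun u => F (γ u).1) (Icc a s) := by
    refine strictMonoOn_of_hasDerivWithinAt_pos (convex_Icc a s)
      (fun u hu => (hFd u hu).continuousWithinAt)
      (fun u hu => (hFd u (interior_subset hu)).mono interior_subset) fun u hu => ?_
    rw [interior_Icc] at hu
    obtain ⟨-, h2, h3⟩ := hP u ⟨hu.1.le, hu.2.le⟩
    rw [gradient_eq_smul_unitNormal h2, real_inner_smul_left]
    have := hqpos u ⟨hu.1.le, hu.2⟩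
    have := norm_pos_iff.2 h2
    positivity
  have h1 := hmono ⟨le_rfl, ha.le⟩ ⟨ha.le, le_rfl⟩ ha
  simp only [hF0] at h1
  exact absurd (hpos a ⟨ha0, ha⟩) (not_lt.2 h1.le)

/-- At the direction of a nondegenerate tangential ray the exit data are not Lipschitz. -/
theorem IsMedium.not_lipschitz_of_tangential {c F G : Space d → ℝ} {Ω D : Set (Space d)}
    {x₀ ξ₀ : Space d} {γ₀ : ℝ → Phase d} (M : IsMedium c F G Ω D) (hx₀ : G x₀ = 0)
    (hξ₀ : ξ₀ ∈ inflow c G x₀) {t T s : ℝ} (h₀ : IsRay c (x₀, ξ₀) t γ₀) (hT : T ∈ Ioo 0 t)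
    (hT0 : G (γ₀ T).1 = 0) (hneg : ∀ u ∈ Ioo 0 T, G (γ₀ u).1 < 0) (hs : s ∈ Ioo 0 T)
    (hmeet : MeetsObstacle c Ω D (x₀, ξ₀) s (γ₀ s)) (hF0 : F (γ₀ s).1 = 0)
    (hpos : ∀ u ∈ Ico 0 s, 0 < F (γ₀ u).1)
    (htan : ⟪unitNormal F (γ₀ s).1, (γ₀ s).2⟫ = 0) (hne : normalRate c F (γ₀ s) ≠ 0)
    (hv : ∃ v, ⟪unitNormal F (γ₀ s).1, fderiv ℝ (fun η => (flow c s (x₀, η)).1) ξ₀ v⟫ ≠ 0)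
    {L : ℝ} :
    ¬ ∀ᶠ ζ in 𝓝[inflow c G x₀] ξ₀,
      ‖exitData c F Ω D (x₀, ζ) - exitData c F Ω D (x₀, ξ₀)‖ ≤ L * ‖ζ - ξ₀‖ := by
  intro hL
  have hexit := M.exitData_eq_of_tangential h₀ hT.2.le hT0 hneg hs hmeet htan
  obtain ⟨L', hL', hnormal⟩ := M.exists_abs_inner_unitNormal_le h₀ hT hs.1 hexit hL
  set τ := (s + T) / 2 with hτ
  have hsτ : s < τ := by rw [hτ]; linarith [hs.2]
  have hτT : τ < T := by rw [hτ]; linarith [hs.2]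
  have hτ0 : 0 < τ := hs.1.trans hsτ
  have hγτ := h₀.mono (hτT.le.trans hT.2.le)
  obtain ⟨K, hK, ε₀, hε₀, hnear⟩ := M.exists_ray_near hx₀ hξ₀ hτ0 hγτ
    fun u hu => hneg u ⟨hu.1, hu.2.trans_lt hτT⟩
  obtain ⟨κ, hκ, A, hA, henter⟩ :=
    M.exists_entering_directions hx₀ hξ₀ hs.1 hsτ.le hγτ hF0 hv
  have hg := M.defF.gradient_ne_zero _ hF0
  have hrate := M.normalRate_pos hs.1 (h₀.mono (hs.2.le.trans hT.2.le)) hF0 hpos htan hne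
  -- Along rays the derivative of `F` is `w` times `n · ξ`.
  set w : Phase d → ℝ := fun Z => c Z.1 ^ 2 * ‖gradient F Z.1‖ with hw
  have hwc : Continuous w := ((M.contDiff.continuous.comp continuous_fst).pow 2).mul
    (M.defF.continuous_gradient.comp continuous_fst).norm
  have hloc : ∀ᶠ Z in 𝓝 (γ₀ s), 0 < normalRate c F Z ∧ gradient F Z.1 ≠ 0 ∧ w Z < w (γ₀ s) + 1 :=
    ((continuousAt_normalRate M.contDiff M.defF hg).eventually (Ioi_mem_nhds hrate)).and
      (((M.defF.continuous_gradient.comp continuous_fst).continuousAt.eventually_ne hg).and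
        (hwc.continuousAt.eventually (Iio_mem_nhds (lt_add_one _))))
  obtain ⟨ρ, hρ, hball⟩ := Metric.eventually_nhds_iff.1 hloc
  set W := w (γ₀ s) + 1 with hW
  have hW0 : 0 < W := by positivity
  have hcont : ContinuousAt γ₀ s :=
    (h₀.continuousOn s ⟨hs.1.le, hs.2.le.trans hT.2.le⟩).continuousAt
      (Icc_mem_nhds hs.1 (hs.2.trans hT.2))
  obtain ⟨δ₁, hδ₁, hδ₁ball⟩ := Metric.continuousAt_iff.1 hcont (ρ / 2) (by positivity)
  -- The constants `W`, `L'`, `A`, `κ` precede `δ`. The last inequality makes the depth reachable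
  -- within time `2 * δ` smaller than `κ * ε`.
  obtain ⟨δ, hδ, hδlt⟩ : ∃ δ > 0, δ < δ₁ ∧ δ < s / 2 ∧ δ < τ - s ∧
      W * (L' * A) * (2 * δ) < κ := by
    have h1 : ∀ᶠ δ : ℝ in 𝓝[>] 0, δ < δ₁ ∧ δ < s / 2 ∧ δ < τ - s ∧ W * (L' * A) * (2 * δ) < κ := by
      have hlt : ∀ r > 0, ∀ᶠ δ : ℝ in 𝓝 0, δ < r := fun r hr => Iio_mem_nhds hr
      refine nhdsWithin_le_nhds ((hlt _ hδ₁).and ((hlt _ (half_pos hs.1)).and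
        ((hlt _ (sub_pos.2 hsτ)).and ?_)))
      refine (Continuous.continuousAt (by fun_prop)).eventually_lt continuousAt_const ?_
      simpa using hκ
    obtain ⟨δ, h2, h3⟩ := (h1.and self_mem_nhdsWithin).exists
    exact ⟨δ, h3, h2⟩
  obtain ⟨hδ1, hδ2, hδ3, hδ4⟩ := hδlt
  obtain ⟨ρ₂, hρ₂, htube⟩ := hγτ.exists_tube (g := fun Z => -F Z.1) (a := 0) (b := s - δ)
    (M.defF.contDiff.continuous.comp continuous_fst).neg le_rfl (by linarith)
    fun u hu => neg_lt_zero.2 (hpos u ⟨hu.1, by linarith [hu.2]⟩)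
  obtain ⟨ε₁, hε₁, hnormal'⟩ := Metric.mem_nhdsWithin_iff.1 hnormal
  have hsmall : ∀ᶠ ε : ℝ in 𝓝[>] 0,
      A * ε < ε₀ ∧ A * ε < ε₁ ∧ A * ε < δ ∧ K * (A * ε) < ρ / 2 ∧ K * (A * ε) < ρ₂ := by
    have h1 : ∀ k : ℝ, ∀ r > 0, ∀ᶠ ε : ℝ in 𝓝 0, k * (A * ε) < r := fun k r hr => by
      refine (Continuous.continuousAt (by fun_prop)).eventually_lt continuousAt_const ?_
      simpa using hr
    have h2 : ∀ r > 0, ∀ᶠ ε : ℝ in 𝓝 0, A * ε < r := fun r hr => by simpa using h1 1 r hr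
    exact nhdsWithin_le_nhds ((h2 _ hε₀).and ((h2 _ hε₁).and ((h2 _ hδ).and
      ((h1 K _ (half_pos hρ)).and (h1 K _ hρ₂)))))
  obtain ⟨ε, ⟨⟨ζ, hζ, s', hζd, hs', hent⟩, hε1, hε2, hε3, hε4, hε5⟩, hε : 0 < ε⟩ :=
    ((henter.and hsmall).and self_mem_nhdsWithin).exists
  obtain ⟨γ, hγ, hγG, hγd⟩ := hnear ζ hζ (hζd.trans_lt hε1)
  have hγd' : ∀ u ∈ Icc 0 τ, dist (γ u) (γ₀ u) ≤ K * (A * ε) := fun u hu =>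
    (hγd u hu).trans (mul_le_mul_of_nonneg_left hζd hK.le)
  have hs'abs := abs_le.1 (hs'.trans hε3.le)
  have hs'τ : s' ≤ τ := by linarith
  have hs'0 : 0 ≤ s' := by linarith
  have hFs' := hent γ hγ hs'τ
  obtain ⟨t₁, ht₁, hmeet₁, hFt₁, -⟩ := M.exists_meetsObstacle (hγ.mono hs'τ) hs'0
    (M.F_pos_of_G_nonneg hx₀.ge)
    (fun u hu h => (hγG u ⟨hu.1, hu.2.le.trans hs'τ⟩).ne (M.defG.mem_frontier_iff.1 h))
    (hFs'.trans (by nlinarith))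
  -- Contact cannot come earlier, as `γ₀` is still clear of the obstacle on `[0, s - δ]`. With `s' ≤
  -- s + δ` this gives `s' - t₁ ≤ 2 * δ`.
  have ht₁δ : s - δ < t₁ := by
    by_contra hle
    have := htube t₁ ⟨ht₁.1.le, not_lt.1 hle⟩ (γ t₁)
      ((hγd' t₁ ⟨ht₁.1.le, ht₁.2.trans hs'τ⟩).trans_lt hε5)
    rw [hFt₁] at this
    simp at this
  have hq : |⟪unitNormal F (γ t₁).1, (γ t₁).2⟫| ≤ L' * (A * ε) :=
    (hnormal' ⟨hζd.trans_lt hε2, hζ⟩ t₁ _ hmeet₁ (by linarith) (by linarith [ht₁.2])).trans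
      (mul_le_mul_of_nonneg_left hζd hL')
  have hIcc : Icc t₁ s' ⊆ Icc 0 τ := Icc_subset_Icc ht₁.1.le hs'τ
  have hP : ∀ u ∈ Icc t₁ s', 0 < normalRate c F (γ u) ∧ gradient F (γ u).1 ≠ 0 ∧ w (γ u) < W := by
    intro u hu
    refine hball ?_
    have h1 : dist (γ₀ u) (γ₀ s) < ρ / 2 := hδ₁ball (by
      rw [Real.dist_eq, abs_lt]
      constructor <;> linarith [hu.1, hu.2])
    linarith [dist_triangle (γ u) (γ₀ u) (γ₀ s), hγd' u (hIcc hu)]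
  have hqd : ∀ u ∈ Icc t₁ s', HasDerivWithinAt (fun u => ⟪unitNormal F (γ u).1, (γ u).2⟫)
      (normalRate c F (γ u)) (Icc t₁ s') u := fun u hu =>
    (hγ.hasDerivWithinAt_inner_unitNormal M.defF (hIcc hu) (hP u hu).2.1).mono hIcc
  have hqmono : MonotoneOn (fun u => ⟪unitNormal F (γ u).1, (γ u).2⟫) (Icc t₁ s') :=
    monotoneOn_of_hasDerivWithinAt_nonneg (convex_Icc t₁ s')
      (fun u hu => (hqd u hu).continuousWithinAt)
      (fun u hu => (hqd u (interior_subset hu)).mono interior_subset)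
      fun u hu => (hP u (interior_subset hu)).1.le
  have hqlow : ∀ u ∈ Icc t₁ s', -(L' * (A * ε)) ≤ ⟪unitNormal F (γ u).1, (γ u).2⟫ := fun u hu =>
    (abs_le.1 hq).1.trans (hqmono ⟨le_rfl, ht₁.2⟩ hu hu.1)
  have hLA : 0 ≤ L' * (A * ε) := by positivity
  -- The linear term compensates the fastest possible decrease of `F`, whose derivative is at least
  -- `-W * (L' * (A * ε))`.
  have hFd : ∀ u ∈ Icc t₁ s', HasDerivWithinAt (fun u => F (γ u).1 + W * (L' * (A * ε)) * u)
      (c (γ u).1 ^ 2 * ⟪gradient F (γ u).1, (γ u).2⟫ + W * (L' * (A * ε)) * 1) (Icc t₁ s') u :=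
    fun u hu => ((hγ.hasDerivWithinAt_comp_fst M.differentiable M.defF.differentiable
      (hIcc hu)).mono hIcc).add ((hasDerivWithinAt_id u _).const_mul _)
  have hFmono : MonotoneOn (fun u => F (γ u).1 + W * (L' * (A * ε)) * u) (Icc t₁ s') := by
    refine monotoneOn_of_hasDerivWithinAt_nonneg (convex_Icc t₁ s')
      (fun u hu => (hFd u hu).continuousWithinAt)
      (fun u hu => (hFd u (interior_subset hu)).mono interior_subset) fun u hu => ?_
    have hu' := interior_subset hu
    obtain ⟨-, h2, h3⟩ := hP u hu'
    have h4 := hqlow u hu'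
    have h5 : 0 ≤ w (γ u) := by positivity
    rw [gradient_eq_smul_unitNormal h2, real_inner_smul_left, ← mul_assoc]
    change 0 ≤ w (γ u) * _ + _
    nlinarith
  have hfin := hFmono ⟨le_rfl, ht₁.2⟩ ⟨ht₁.2, le_rfl⟩ ht₁.2
  simp only [hFt₁, zero_add] at hfin
  have h6 : W * (L' * (A * ε)) * (s' - t₁) ≤ W * (L' * (A * ε)) * (2 * δ) :=
    mul_le_mul_of_nonneg_left (by linarith) (by positivity)
  have h7 : W * (L' * A) * (2 * δ) * ε < κ * ε := mul_lt_mul_of_pos_right hδ4 hε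
  nlinarith

end BrokenRay

/-! ### The free ray misses, grazes or crosses the obstacle. -/

open Filter Topology in
theorem lemma6 {d : ℕ} (c F G : Space d → ℝ) (Ω D : Set (Space d))
    (hΩ : IsCompact Ω)
    (hG : IsC2DefiningFunction G Ω)
    (hF : IsC2DefiningFunction F D)
    (hD : D ⊆ interior Ω)
    (hc : ContDiff ℝ 3 c)
    (hc_pos : ∀ x ∈ Ω, 0 < c x)
    (hc_nontrapping : NonTrapping c Ω)
    (x₀ : Space d) (hx₀ : x₀ ∈ frontier Ω)
    (C : Set (Space d))
    (hC : IsSmallestSimplyConnected c G Ω D x₀ C)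
    (ξ₀ : inflow c G x₀)
    (hξ₀ : ξ₀ ∈ frontier (Subtype.val ⁻¹' C : Set (inflow c G x₀)))
    (h_exit : TransversalExit c F G Ω D x₀ ξ₀)
    (h_tangency : NondegenerateTangency c F Ω D x₀ ξ₀) :
    ¬ HasContinuousDerivAt (inflow c G x₀) (travelTime c F Ω D x₀) ξ₀ ∨
      ¬ HasContinuousDerivAt (inflow c G x₀) (exitLocation c F Ω D x₀) ξ₀ ∨
      ¬ HasContinuousDerivAt (inflow c G x₀) (exitDirection c F Ω D x₀) ξ₀ := by
  have M : IsMedium c F G Ω D := ⟨hG, hF, hD, hc, hc_pos, hc_nontrapping⟩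
  have hGx₀ : G x₀ = 0 := hG.mem_frontier_iff.1 hx₀
  rw [← not_and_or, ← not_and_or]
  -- Differentiability at `ξ₀` alone is already contradictory.
  rintro ⟨⟨hT, -⟩, ⟨hY, -⟩, ⟨hη, -⟩⟩
  obtain ⟨t, γ₀, h₀, T, hTt, hT0, hneg⟩ := M.exists_first_exit hGx₀ ξ₀.2
  have hγT := h₀.mono hTt.2.le
  by_cases hmiss : ∀ u ∈ Ioo 0 T, 0 < F (γ₀ u).1
  · exact M.not_continuousWithinAt_travelTime hGx₀ h₀ hTt hT0 hneg hmiss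
      (mem_closure_brokenDirections M hGx₀ hC hξ₀) hT.continuousWithinAt
  push Not at hmiss
  obtain ⟨b, hb, hFb⟩ := hmiss
  obtain ⟨s, hs, hmeet, hF0, hpos⟩ := M.exists_meetsObstacle (hγT.mono hb.2.le) hb.1.le
    (M.F_pos_of_G_nonneg hGx₀.ge)
    (fun u hu h => (hneg u ⟨hu.1, hu.2.trans hb.2⟩).ne (hG.mem_frontier_iff.1 h)) hFb
  have hsT : s < T := hs.2.trans_lt hb.2
  by_cases htan : ⟪unitNormal F (γ₀ s).1, (γ₀ s).2⟫ = 0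
  · obtain ⟨hne, -, hv⟩ := h_tangency s (γ₀ s) ⟨hmeet, htan⟩
    have hdiff : DifferentiableWithinAt ℝ (fun ζ => exitData c F Ω D (x₀, ζ)) (inflow c G x₀) ξ₀ :=
      hT.prodMk (hY.prodMk hη)
    -- Differentiability enters the grazing case only through this Lipschitz bound at `ξ₀`.
    obtain ⟨L, hL⟩ := hdiff.hasFDerivWithinAt.isBigO_sub.bound
    exact M.not_lipschitz_of_tangential hGx₀ ξ₀.2 h₀ hTt hT0 hneg ⟨hs.1, hsT⟩ hmeet hF0 hpos htan
      hne hv hL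
  · have hg := hF.gradient_ne_zero _ hF0
    have hcs : 0 < c (γ₀ s).1 := hc_pos _ (hG.mem_iff.2 (hneg s ⟨hs.1, hsT⟩).le)
    have hder := (h₀.hasDerivWithinAt_comp_fst M.differentiable hF.differentiable
      (s := s) ⟨hs.1.le, hsT.le.trans hTt.2.le⟩).hasDerivAt
        (Icc_mem_nhds hs.1 (hsT.trans hTt.2))
    set m := c (γ₀ s).1 ^ 2 * ⟪gradient F (γ₀ s).1, (γ₀ s).2⟫ with hm
    have hm0 : m ≠ 0 := by
      rw [hm, gradient_eq_smul_unitNormal hg, real_inner_smul_left]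
      exact mul_ne_zero (by positivity) (mul_ne_zero (norm_ne_zero_iff.2 hg) htan)
    have hslope := hasDerivAt_iff_tendsto_slope.1 hder
    -- `F` is positive before `s` and zero at `s`, so its nonzero derivative there is negative.
    have hmneg : m < 0 := by
      refine hm0.lt_or_gt.resolve_right fun hmpos => ?_
      have h1 := hslope.mono_left (nhdsWithin_mono (s := Iio s) s fun u (hu : u < s) => hu.ne)
      obtain ⟨u, hu, hu0⟩ := ((h1.eventually (Ioi_mem_nhds hmpos)).and
        (Ioo_mem_nhdsLT hs.1)).exists
      rw [slope_def_field, hF0, sub_zero] at hu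
      exact absurd (hpos u ⟨hu0.1.le, hu0.2⟩) fun h =>
        absurd hu (not_lt.2 (div_neg_of_pos_of_neg h (sub_neg.2 hu0.2)).le)
    have h1 := hslope.mono_left (nhdsWithin_mono (s := Ioi s) s fun u (hu : s < u) => hu.ne')
    obtain ⟨τ, hτ, hτs⟩ := ((h1.eventually (Iio_mem_nhds hmneg)).and
      (Ioo_mem_nhdsGT hsT)).exists
    rw [slope_def_field, hF0, sub_zero] at hτ
    have hFτ : F (γ₀ τ).1 < 0 := by
      by_contra h
      exact absurd hτ (not_lt.2 (div_nonneg (not_lt.1 h) (sub_nonneg.2 hτs.1.le)))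
    have hmem := M.brokenDirections_mem_nhdsWithin hGx₀ ξ₀.2 (hs.1.trans hτs.1)
      (hγT.mono hτs.2.le) (fun u hu => hneg u ⟨hu.1, hu.2.trans_lt hτs.2⟩) hFτ
    -- `𝓑 ⊆ C` is a relative neighbourhood of `ξ₀`, so `ξ₀` is not in the relative boundary of `C`.
    refine hξ₀.2 (mem_interior_iff_mem_nhds.2 ?_)
    exact mem_of_superset (preimage_coe_mem_nhds_subtype.2 hmem) (preimage_mono hC.1.1)
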